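/- Let $(M^\star,g^\star)$ be a smooth Riemannian manifold of dimension $n-1\ge 2$, $I\subseteq\mathbb R$ an open interval (or, more generally, an open set), and $a:I\to\mathbb R$, $b:M^\star\to\mathbb R$ smooth nowhere vanishing functions. On the $n$-dimensional doubly warped spacetime $I\times M^\star$ with metric $$ds^2=-b^2(\mathbf x)\,dt^2+a^2(t)\,g^\star_{\mu\nu}(\mathbf x)\,dx^\mu dx^\nu$$ let $u_i$ be the comoving unit velocity, $u_0=-b$, $u_\mu=0$ (so $u^iu_i=-1$); let $\nabla$ be the Levi-Civita connection, $\dot X=u^k\nabla_kX$, $\dot u_j=u^k\nabla_ku_j$, and $$\varphi=\frac{\nabla_pu^p}{n-1},\qquad \xi=(n-1)(\varphi^2+\dot\varphi),\qquad \eta=\dot u^p\dot u_p .$$ Let $R_{jkl}{}^m$ be the Riemann tensor, $R_{jkl}{}^m\omega_m=[\nabla_j,\nabla_k]\omega_l$, $R_{jl}=R_{jml}{}^m$ the Ricci tensor, $R=g^{jl}R_{jl}$ the scalar curvature, and let $$C_{jklm}=R_{jklm}+\frac{g_{jm}R_{kl}-g_{km}R_{jl}+R_{jm}g_{kl}-R_{km}g_{jl}}{n-2}-R\,\frac{g_{jm}g_{kl}-g_{km}g_{jl}}{(n-1)(n-2)}$$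 be the Weyl tensor and $E_{kl}=u^ju^mC_{jklm}$ the electric tensor. Where $\eta\neq0$ put $$N_{jk}=g_{jk}+u_ju_k-\frac{\dot u_j\dot u_k}{\eta},\qquad w_k=\frac1{2\eta}N_{km}\nabla^m\eta,\qquad \Pi_{jk}=\Big[N_{jr}N_{ks}-\frac{N_{jk}N_{rs}}{n-2}\Big]\nabla^r\dot u^s .$$ Then at every point where $\eta\ne0$ (equivalently $\dot u_j\neq 0$) the Ricci tensor is $$\begin{aligned}R_{jk}={}&u_ju_k\Big[\frac{R-n\xi}{n-1}+\nabla^p\dot u_p+\eta+\frac{\dot u^s\nabla_s\eta}{2\eta}\Big]+g_{jk}\Big[\frac{R-\xi}{n-1}+\eta+\frac{\dot u^s\nabla_s\eta}{2\eta}\Big]\\&-(n-2)\varphi\,(u_j\dot u_k+\dot u_ju_k)-\frac{\dot u_j\dot u_k}{\eta}\Big[(n-1)\Big(\eta+\frac{\dot u^s\nabla_s\eta}{2\eta}\Big)-\nabla^p\dot u_p\Big]\\&-(n-2)\big[\dot u_jw_k+w_j\dot u_k+\Pi_{jk}+E_{jk}\big].\end{aligned}$$ (Tensor components refer to coordinates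 $(t,x^\mu)$ with $t$ the coordinate of $I$ and $x^\mu$ an arbitrary smooth chart of $M^\star$.) -/

import Mathlib

open scoped Manifold ContDiff BigOperators

noncomputable section

namespace DoublyWarped

/-! ## Tensor calculus in coordinates

A point of a coordinate domain is `X : Fin n → ℝ`.  A scalar field is a function
`(Fin n → ℝ) → ℝ`, a covector field `θ` has components `θ X i`, and a covariant 2-tensor field
(in particular a metric `g`) has components `g X i j`.  All metrics may have any signature. -/

section Calculus

variable {n : ℕ}

/-- The partial derivative `∂_k f`. -/
def pd (k : Fin n) (f : (Fin n → ℝ) → ℝ) (X : Fin n → ℝ) : ℝ :=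
  fderiv ℝ f X (Pi.single k 1)

/-- The contravariant components `g^{ij}` of the metric. -/
def gInv (g : (Fin n → ℝ) → Matrix (Fin n) (Fin n) ℝ) (X : Fin n → ℝ) :
    Matrix (Fin n) (Fin n) ℝ :=
  (g X)⁻¹

/-- The Christoffel symbols
`Γ^k_{ij} = ½ g^{kl} (∂_i g_{jl} + ∂_j g_{il} - ∂_l g_{ij})`. -/
def christoffel (g : (Fin n → ℝ) → Matrix (Fin n) (Fin n) ℝ) (X : Fin n → ℝ)
    (k i j : Fin n) : ℝ :=
  (1 / 2) * ∑ l, gInv g X k l *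
    (pd i (fun Y => g Y j l) X + pd j (fun Y => g Y i l) X - pd l (fun Y => g Y i j) X)

/-- The covariant derivative of a covector field, `∇_i θ_j = ∂_i θ_j - Γ^k_{ij} θ_k`. -/
def nabla (g : (Fin n → ℝ) → Matrix (Fin n) (Fin n) ℝ) (θ : (Fin n → ℝ) → Fin n → ℝ)
    (X : Fin n → ℝ) (i j : Fin n) : ℝ :=
  pd i (fun Y => θ Y j) X - ∑ k, christoffel g X k i j * θ X k

/-- Raising the index of a covector, `θ^i = g^{ij} θ_j`. -/
def sharp (g : (Fin n → ℝ) → Matrix (Fin n) (Fin n) ℝ) (θ : (Fin n → ℝ) → Fin n → ℝ)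
    (X : Fin n → ℝ) (i : Fin n) : ℝ :=
  ∑ j, gInv g X i j * θ X j

/-- The divergence `∇^p θ_p = g^{ij} ∇_i θ_j`. -/
def divergence (g : (Fin n → ℝ) → Matrix (Fin n) (Fin n) ℝ) (θ : (Fin n → ℝ) → Fin n → ℝ)
    (X : Fin n → ℝ) : ℝ :=
  ∑ i, ∑ j, gInv g X i j * nabla g θ X i j

/-- The derivative `θ^k ∇_k f` of a scalar field along a covector field with raised index. -/
def scalarAlong (g : (Fin n → ℝ) → Matrix (Fin n) (Fin n) ℝ) (θ : (Fin n → ℝ) → Fin n → ℝ)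
    (f : (Fin n → ℝ) → ℝ) (X : Fin n → ℝ) : ℝ :=
  ∑ k, sharp g θ X k * pd k f X

/-- The Riemann tensor
`R_{jkl}{}^m = -∂_j Γ^m_{kl} + ∂_k Γ^m_{jl} + Γ^p_{jl} Γ^m_{kp} - Γ^p_{kl} Γ^m_{jp}`;
with this sign, `R_{jkl}{}^m θ_m = (∇_j ∇_k - ∇_k ∇_j) θ_l`. -/
def riemann (g : (Fin n → ℝ) → Matrix (Fin n) (Fin n) ℝ) (X : Fin n → ℝ)
    (j k l m : Fin n) : ℝ :=
  -pd j (fun Y => christoffel g Y m k l) X + pd k (fun Y => christoffel g Y m j l) X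
    + ∑ p, (christoffel g X p j l * christoffel g X m k p
        - christoffel g X p k l * christoffel g X m j p)

/-- The covariant Riemann tensor `R_{jklm} = R_{jkl}{}^p g_{pm}`. -/
def riemannLow (g : (Fin n → ℝ) → Matrix (Fin n) (Fin n) ℝ) (X : Fin n → ℝ)
    (j k l m : Fin n) : ℝ :=
  ∑ p, riemann g X j k l p * g X p m

/-- The Ricci tensor `R_{jl} = R_{jml}{}^m`, that is
`∂_m Γ^m_{jl} - ∂_j Γ^m_{ml} + Γ^p_{jl} Γ^m_{mp} - Γ^p_{ml} Γ^m_{jp}`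
(positive on round spheres). -/
def ricci (g : (Fin n → ℝ) → Matrix (Fin n) (Fin n) ℝ) (X : Fin n → ℝ) (j l : Fin n) : ℝ :=
  ∑ m, riemann g X j m l m

/-- The scalar curvature `R = g^{ij} R_{ij}`. -/
def scalarCurvature (g : (Fin n → ℝ) → Matrix (Fin n) (Fin n) ℝ) (X : Fin n → ℝ) : ℝ :=
  ∑ i, ∑ j, gInv g X i j * ricci g X i j

/-- The (covariant) Weyl tensor `C_{jklm}` in dimension `n ≥ 3`. -/
def weyl (g : (Fin n → ℝ) → Matrix (Fin n) (Fin n) ℝ) (X : Fin n → ℝ)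
    (j k l m : Fin n) : ℝ :=
  riemannLow g X j k l m
    + (g X j m * ricci g X k l - g X k m * ricci g X j l
        + ricci g X j m * g X k l - ricci g X k m * g X j l) / ((n : ℝ) - 2)
    - scalarCurvature g X * (g X j m * g X k l - g X k m * g X j l)
        / (((n : ℝ) - 1) * ((n : ℝ) - 2))

end Calculus

/-! ## Kinematics of a unit covector field `u`, in coordinates -/

section Kinematics

variable {n : ℕ}

/-- The acceleration `u̇_j = u^k ∇_k u_j`. -/
def accel (g : (Fin n → ℝ) → Matrix (Fin n) (Fin n) ℝ) (u : (Fin n → ℝ) → Fin n → ℝ)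
    (X : Fin n → ℝ) (j : Fin n) : ℝ :=
  ∑ k, sharp g u X k * nabla g u X k j

/-- The expansion scalar `φ = ∇_p u^p / (n - 1)`. -/
def expansion (g : (Fin n → ℝ) → Matrix (Fin n) (Fin n) ℝ) (u : (Fin n → ℝ) → Fin n → ℝ)
    (X : Fin n → ℝ) : ℝ :=
  divergence g u X / ((n : ℝ) - 1)

/-- The scalar `ξ = (n - 1) (φ² + φ̇)`, where `φ̇ = u^k ∇_k φ`. -/
def xi (g : (Fin n → ℝ) → Matrix (Fin n) (Fin n) ℝ) (u : (Fin n → ℝ) → Fin n → ℝ)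
    (X : Fin n → ℝ) : ℝ :=
  ((n : ℝ) - 1) * (expansion g u X ^ 2 + scalarAlong g u (expansion g u) X)

/-- The scalar `η = u̇^p u̇_p`. -/
def eta (g : (Fin n → ℝ) → Matrix (Fin n) (Fin n) ℝ) (u : (Fin n → ℝ) → Fin n → ℝ)
    (X : Fin n → ℝ) : ℝ :=
  ∑ p, sharp g (accel g u) X p * accel g u X p

/-- The projector `N_{jk} = g_{jk} + u_j u_k - u̇_j u̇_k / η` (where `η ≠ 0`). -/
def projN (g : (Fin n → ℝ) → Matrix (Fin n) (Fin n) ℝ) (u : (Fin n → ℝ) → Fin n → ℝ)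
    (X : Fin n → ℝ) (j k : Fin n) : ℝ :=
  g X j k + u X j * u X k - accel g u X j * accel g u X k / eta g u X

/-- The covector `w_k = (1 / (2 η)) N_{km} ∇^m η` (where `η ≠ 0`). -/
def wVec (g : (Fin n → ℝ) → Matrix (Fin n) (Fin n) ℝ) (u : (Fin n → ℝ) → Fin n → ℝ)
    (X : Fin n → ℝ) (k : Fin n) : ℝ :=
  1 / (2 * eta g u X)
    * ∑ m, projN g u X k m * ∑ p, gInv g X m p * pd p (eta g u) X

/-- The gradient of the acceleration with both indices raised, `∇^r u̇^s`. -/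
def gradAccelUp (g : (Fin n → ℝ) → Matrix (Fin n) (Fin n) ℝ) (u : (Fin n → ℝ) → Fin n → ℝ)
    (X : Fin n → ℝ) (r s : Fin n) : ℝ :=
  ∑ p, ∑ q, gInv g X r p * gInv g X s q * nabla g (accel g u) X p q

/-- The tensor `Π_{jk} = [N_{jr} N_{ks} - N_{jk} N_{rs} / (n - 2)] ∇^r u̇^s`
(where `η ≠ 0` and `n ≥ 3`). -/
def piTensor (g : (Fin n → ℝ) → Matrix (Fin n) (Fin n) ℝ) (u : (Fin n → ℝ) → Fin n → ℝ)
    (X : Fin n → ℝ) (j k : Fin n) : ℝ :=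
  ∑ r, ∑ s, (projN g u X j r * projN g u X k s
      - projN g u X j k * projN g u X r s / ((n : ℝ) - 2)) * gradAccelUp g u X r s

/-- The electric tensor `E_{kl} = u^j u^m C_{jklm}`. -/
def electric (g : (Fin n → ℝ) → Matrix (Fin n) (Fin n) ℝ) (u : (Fin n → ℝ) → Fin n → ℝ)
    (X : Fin n → ℝ) (k l : Fin n) : ℝ :=
  ∑ j, ∑ m, sharp g u X j * sharp g u X m * weyl g X j k l m

end Kinematics

/-! ## Doubly warped spacetimes

The spacetime is `I × M` with `I ⊆ ℝ` open and `M` a Riemannian manifold of dimension `m = n - 1`.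
Its coordinates are `(t, x) : Fin (m + 1) → ℝ`, where `x` are the coordinates of a chart `e` of
`M`: the index `0` is time and the index `μ.succ` is the space index `μ`. -/

section Spacetime

variable {m : ℕ} {M : Type*} [TopologicalSpace M] [ChartedSpace (EuclideanSpace ℝ (Fin m)) M]
  [IsManifold (𝓡 m) ∞ M]

/-- The space part `x` of `(t, x)`. -/
def spacePart (X : Fin (m + 1) → ℝ) : EuclideanSpace ℝ (Fin m) :=
  WithLp.toLp 2 fun μ => X μ.succ

/-- The components `g⋆_{μν}(x) = g⋆(∂_μ, ∂_ν)` of a Riemannian metric in a chart `e` of `M`. -/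
def chartMetric
    (gs : Bundle.ContMDiffRiemannianMetric (𝓡 m) ∞ (EuclideanSpace ℝ (Fin m))
      (TangentSpace (𝓡 m) : M → Type _))
    (e : OpenPartialHomeomorph M (EuclideanSpace ℝ (Fin m)))
    (x : EuclideanSpace ℝ (Fin m)) (μ ν : Fin m) : ℝ :=
  gs.inner (e.symm x)
    (mfderiv (𝓡 m) (𝓡 m) e.symm x (EuclideanSpace.single μ (1 : ℝ)))
    (mfderiv (𝓡 m) (𝓡 m) e.symm x (EuclideanSpace.single ν (1 : ℝ)))

/-- The components of the doubly warped metric `-b²(x) dt² + a²(t) g⋆_{μν}(x) dx^μ dx^ν`. -/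
def metric (a : ℝ → ℝ) (b : M → ℝ)
    (gs : Bundle.ContMDiffRiemannianMetric (𝓡 m) ∞ (EuclideanSpace ℝ (Fin m))
      (TangentSpace (𝓡 m) : M → Type _))
    (e : OpenPartialHomeomorph M (EuclideanSpace ℝ (Fin m)))
    (X : Fin (m + 1) → ℝ) : Matrix (Fin (m + 1)) (Fin (m + 1)) ℝ :=
  Matrix.of fun i j =>
    Fin.cases (Fin.cases (-(b (e.symm (spacePart X))) ^ 2) (fun _ => 0) j)
      (fun μ => Fin.cases 0 (fun ν => a (X 0) ^ 2 * chartMetric gs e (spacePart X) μ ν) j) i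

/-- The comoving unit velocity, `u_0 = -b`, `u_μ = 0` (so that `u^0 = 1 / b`). -/
def velocity (b : M → ℝ) (e : OpenPartialHomeomorph M (EuclideanSpace ℝ (Fin m)))
    (X : Fin (m + 1) → ℝ) : Fin (m + 1) → ℝ :=
  Fin.cons (-b (e.symm (spacePart X))) fun _ => 0

end Spacetime

end DoublyWarped

end

/-!
The curvature of the fibre metric `g⋆` never has to be known. The definition of the electric tensor
`E_{kl} = u^j u^m C_{jklm}` contains the Ricci tensor linearly, with the coefficient `-1 / (n - 2)`
in front of `R_{kl}`, so it can be solved for `R_{kl}`; what remains on the other side is the scalar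
curvature, `R_{kl} u^l`, `R_{kl} u^k u^l`, and the tidal tensor `u^j u^m R_{jklm}`. All of these
contractions are determined by the connection along the comoving observer, and for the metric
`-b² dt² + a² g⋆` the Christoffel symbols with a time index are explicit.

With `H = a' / a` and `q_μ = ∂_μ b / b`, the acceleration is `u̇ = (0, q)`, the expansion is
`φ = H / b`, and `ξ = (n - 1) (H' + H²) / b²`. In components, `R_{0μν}{}^0` is
`-ξ g_{μν} / (n - 1) + ∇_μ u̇_ν + q_μ q_ν` (`riemann_zero_succ_succ_zero`), the mixed Ricci
components are `(n - 2) H q_μ` (`ricci_zero_succ`, `ricci_succ_zero`), and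
`R_{00} = b² (∇^p u̇_p - ξ)` (`ricci_zero_zero`). For the last one, `Γ^p_{00} = b² u̇^p`, so that
`∂_p Γ^p_{00} + Γ^p_{pl} Γ^l_{00}` is a divergence up to first-order terms. This gives the spatial
Ricci tensor in terms of `∇_μ u̇_ν` and `E` (`ricci_succ_succ`).

It remains to split `∇_μ u̇_ν` along and across `u̇`. Metric compatibility gives
`∂_k η = 2 u̇^p ∇_k u̇_p` (`pd_eta`), and since `u̇` is closed, `∇_j u̇_k` is symmetric
(`nabla_accel_symm`); hence both contractions of `∇ u̇` with `u̇` are gradients of `η`, which is what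
`w` and `u̇^s ∇_s η` record. The transverse part is `Π` and the transverse trace is
`∇^p u̇_p - η - u̇^s ∇_s η / (2 η)` (`sum_projN_gradAccelUp`). Substitution is then field algebra,
component by component (`ricci_eq`).

The argument works for data given as functions on an open set of coordinate space (`IsWarping`).
That a Riemannian metric on a manifold has such components in every chart of the maximal atlas is
`isWarping_chart`.
-/

noncomputable section

namespace DoublyWarped

open Filter Topology

/-! ### Partial derivatives -/

section PartialDerivatives

variable {n : ℕ} {X : Fin n → ℝ}

lemma pd_congr {f h : (Fin n → ℝ) → ℝ} (hfh : f =ᶠ[𝓝 X] h) (k : Fin n) :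
    pd k f X = pd k h X := by
  simp only [pd, hfh.fderiv_eq]

lemma pd_const (k : Fin n) (c : ℝ) : pd k (fun _ => c) X = 0 := by
  simp [pd]

lemma pd_mul {f h : (Fin n → ℝ) → ℝ} (hf : DifferentiableAt ℝ f X) (hh : DifferentiableAt ℝ h X)
    (k : Fin n) : pd k (fun Y => f Y * h Y) X = pd k f X * h X + f X * pd k h X := by
  simp only [pd]
  rw [show (fun Y => f Y * h Y) = f * h from rfl, fderiv_mul hf hh]
  simp
  ring

lemma pd_div {f h : (Fin n → ℝ) → ℝ} (hf : DifferentiableAt ℝ f X) (hh : DifferentiableAt ℝ h X)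
    (hX : h X ≠ 0) (k : Fin n) :
    pd k (fun Y => f Y / h Y) X = (pd k f X * h X - f X * pd k h X) / h X ^ 2 := by
  have hd : DifferentiableAt ℝ (fun Y => f Y / h Y) X := by
    simp only [div_eq_mul_inv]
    exact hf.mul (hh.inv hX)
  have hne : ∀ᶠ Y in 𝓝 X, h Y ≠ 0 := hh.continuousAt.eventually_ne hX
  have key : pd k f X = pd k (fun Y => f Y / h Y) X * h X + f X / h X * pd k h X := by
    rw [← pd_mul hd hh]
    refine pd_congr ?_ k
    filter_upwards [hne] with Y hY
    field_simp
  rw [key]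
  field_simp
  ring

lemma pd_neg (f : (Fin n → ℝ) → ℝ) (k : Fin n) : pd k (fun Y => -f Y) X = -pd k f X := by
  simp [pd]

lemma pd_sum {ι : Type*} (s : Finset ι) {f : ι → (Fin n → ℝ) → ℝ}
    (hf : ∀ i ∈ s, DifferentiableAt ℝ (f i) X) (k : Fin n) :
    pd k (fun Y => ∑ i ∈ s, f i Y) X = ∑ i ∈ s, pd k (f i) X := by
  simp only [pd]
  rw [fderiv_fun_sum hf]
  simp

lemma pd_sum_mul {ι : Type*} (s : Finset ι) (f h : ι → (Fin n → ℝ) → ℝ)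
    (hf : ∀ i, DifferentiableAt ℝ (f i) X) (hh : ∀ i, DifferentiableAt ℝ (h i) X) (k : Fin n) :
    pd k (fun Y => ∑ i ∈ s, f i Y * h i Y) X
      = ∑ i ∈ s, (pd k (f i) X * h i X + f i X * pd k (h i) X) := by
  rw [pd_sum s (f := fun i Y => f i Y * h i Y) fun i _ => (hf i).mul (hh i)]
  exact Finset.sum_congr rfl fun i _ => pd_mul (hf i) (hh i) k

end PartialDerivatives

/-! ### Metric compatibility of the Christoffel symbols -/

section LeviCivita

variable {n : ℕ} {g : (Fin n → ℝ) → Matrix (Fin n) (Fin n) ℝ} {X : Fin n → ℝ}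

open Matrix

/-- `∂_k F` for a matrix-valued `F`, taken entrywise. -/
def pdMatrix (k : Fin n) (F : (Fin n → ℝ) → Matrix (Fin n) (Fin n) ℝ) (X : Fin n → ℝ) :
    Matrix (Fin n) (Fin n) ℝ :=
  Matrix.of fun i j => pd k (fun Y => F Y i j) X

/-- The connection matrix `Γ_k`, with entries `Γ^i_{kj}`. -/
def connMatrix (g : (Fin n → ℝ) → Matrix (Fin n) (Fin n) ℝ) (X : Fin n → ℝ) (k : Fin n) :
    Matrix (Fin n) (Fin n) ℝ :=
  Matrix.of fun i j => christoffel g X i k j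

lemma pd_metric_symm (hsymm : ∀ᶠ Y in 𝓝 X, (g Y).IsSymm) (k i j : Fin n) :
    pd k (fun Y => g Y i j) X = pd k (fun Y => g Y j i) X := by
  refine pd_congr ?_ k
  filter_upwards [hsymm] with Y hY
  exact hY.apply j i

lemma christoffel_symm (hsymm : ∀ᶠ Y in 𝓝 X, (g Y).IsSymm) (k i j : Fin n) :
    christoffel g X k i j = christoffel g X k j i := by
  simp only [christoffel]
  congr 1
  refine Finset.sum_congr rfl fun l _ => ?_
  rw [pd_metric_symm hsymm l i j]
  ring

/-- The Christoffel symbols of the first kind: lowering the upper index cancels the inverse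
metric. -/
lemma metric_mul_connMatrix (hdet : IsUnit (g X).det) (k i j : Fin n) :
    (g X * connMatrix g X k) i j =
      (1 / 2) * (pd k (fun Y => g Y j i) X + pd j (fun Y => g Y k i) X
        - pd i (fun Y => g Y k j) X) := by
  set v : Fin n → ℝ := fun l =>
    pd k (fun Y => g Y j l) X + pd j (fun Y => g Y k l) X - pd l (fun Y => g Y k j) X with hv
  have h1 : (g X * connMatrix g X k) i j = (1 / 2) * (g X *ᵥ ((g X)⁻¹ *ᵥ v)) i := by
    simp only [Matrix.mul_apply, connMatrix, Matrix.of_apply, christoffel, gInv, Matrix.mulVec,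
      dotProduct, Finset.mul_sum, hv]
    refine Finset.sum_congr rfl fun p _ => Finset.sum_congr rfl fun l _ => ?_
    ring
  rw [h1, Matrix.mulVec_mulVec, Matrix.mul_nonsing_inv _ hdet, Matrix.one_mulVec]

/-- Metric compatibility: `∂_k g = Γ_kᵀ g + g Γ_k`. -/
lemma pdMatrix_metric (hsymm : ∀ᶠ Y in 𝓝 X, (g Y).IsSymm) (hdet : IsUnit (g X).det) (k : Fin n) :
    pdMatrix k g X = (connMatrix g X k)ᵀ * g X + g X * connMatrix g X k := by
  have ht : (connMatrix g X k)ᵀ * g X = (g X * connMatrix g X k)ᵀ := by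
    rw [Matrix.transpose_mul, hsymm.self_of_nhds.eq]
  ext i j
  rw [ht, Matrix.add_apply, Matrix.transpose_apply, metric_mul_connMatrix hdet,
    metric_mul_connMatrix hdet, pd_metric_symm hsymm i k j, pd_metric_symm hsymm j k i,
    pd_metric_symm hsymm k j i, pd_metric_symm hsymm i j k, pd_metric_symm hsymm j i k]
  simp only [pdMatrix, Matrix.of_apply]
  ring

lemma differentiableAt_det {N : ℕ} {F : (Fin n → ℝ) → Matrix (Fin N) (Fin N) ℝ}
    (hF : ∀ i j, DifferentiableAt ℝ (fun Y => F Y i j) X) :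
    DifferentiableAt ℝ (fun Y => (F Y).det) X := by
  simp only [Matrix.det_apply]
  refine DifferentiableAt.fun_sum fun σ _ => ?_
  simp only [Units.smul_def, zsmul_eq_mul]
  refine DifferentiableAt.const_mul ?_ _
  fun_prop

lemma differentiableAt_gInv (hg : ∀ i j, DifferentiableAt ℝ (fun Y => g Y i j) X)
    (hdet : IsUnit (g X).det) (i j : Fin n) :
    DifferentiableAt ℝ (fun Y => gInv g Y i j) X := by
  have hadj : DifferentiableAt ℝ (fun Y => (g Y).adjugate i j) X := by
    simp only [Matrix.adjugate_apply]
    refine differentiableAt_det fun r s => ?_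
    by_cases hr : r = j
    · subst hr
      simp
    · simpa [Matrix.updateRow_ne hr] using hg r s
  have : (fun Y => gInv g Y i j) = fun Y => ((g Y).det)⁻¹ * (g Y).adjugate i j := by
    funext Y
    simp [gInv, Matrix.inv_def]
  rw [this]
  exact ((differentiableAt_det hg).inv hdet.ne_zero).mul hadj

/-- The inverse metric is parallel: `∂_k g⁻¹ = -Γ_k g⁻¹ - g⁻¹ Γ_kᵀ`. -/
lemma pdMatrix_gInv (hsymm : ∀ᶠ Y in 𝓝 X, (g Y).IsSymm)
    (hg : ∀ i j, DifferentiableAt ℝ (fun Y => g Y i j) X) (hdet : IsUnit (g X).det) (k : Fin n) :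
    pdMatrix k (gInv g) X =
      -(connMatrix g X k * gInv g X) - gInv g X * (connMatrix g X k)ᵀ := by
  have hgi := differentiableAt_gInv hg hdet
  have hev : ∀ᶠ Y in 𝓝 X, IsUnit (g Y).det := by
    filter_upwards [(differentiableAt_det hg).continuousAt.eventually_ne hdet.ne_zero] with Y hY
    exact isUnit_iff_ne_zero.2 hY
  have hleib : pdMatrix k (gInv g) X * g X + gInv g X * pdMatrix k g X = 0 := by
    ext i j
    have h0 : pd k (fun Y => ∑ l, gInv g Y i l * g Y l j) X = 0 := by
      rw [← pd_const (X := X) k ((1 : Matrix (Fin n) (Fin n) ℝ) i j)]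
      refine pd_congr ?_ k
      filter_upwards [hev] with Y hY
      rw [← Matrix.mul_apply, gInv, Matrix.nonsing_inv_mul _ hY]
    rw [pd_sum_mul _ (fun l Y => gInv g Y i l) (fun l Y => g Y l j) (hgi i) fun l => hg l j] at h0
    simp only [Matrix.add_apply, Matrix.mul_apply, pdMatrix, Matrix.of_apply, Matrix.zero_apply,
      ← Finset.sum_add_distrib]
    exact h0
  have hr : g X * gInv g X = 1 := Matrix.mul_nonsing_inv _ hdet
  have hl : gInv g X * g X = 1 := Matrix.nonsing_inv_mul _ hdet
  rw [pdMatrix_metric hsymm hdet] at hleib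
  -- multiply the Leibniz rule for `g⁻¹ g = 1` by `g⁻¹` on the right
  calc pdMatrix k (gInv g) X
      = (pdMatrix k (gInv g) X * g X
          + gInv g X * ((connMatrix g X k)ᵀ * g X + g X * connMatrix g X k)) * gInv g X
        - gInv g X * (connMatrix g X k)ᵀ * (g X * gInv g X)
        - (gInv g X * g X) * connMatrix g X k * gInv g X
        + pdMatrix k (gInv g) X * (1 - g X * gInv g X) := by noncomm_ring
    _ = _ := by rw [hleib, hr, hl]; noncomm_ring

/-- Index raising commutes with the covariant derivative:
`∂_k θ^i = g^{ij} ∇_k θ_j - Γ^i_{kl} θ^l`. -/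
lemma pd_sharp (hsymm : ∀ᶠ Y in 𝓝 X, (g Y).IsSymm)
    (hg : ∀ i j, DifferentiableAt ℝ (fun Y => g Y i j) X) (hdet : IsUnit (g X).det)
    {θ : (Fin n → ℝ) → Fin n → ℝ} (hθ : ∀ i, DifferentiableAt ℝ (fun Y => θ Y i) X)
    (k i : Fin n) :
    pd k (fun Y => sharp g θ Y i) X =
      ∑ j, gInv g X i j * nabla g θ X k j - ∑ l, christoffel g X i k l * sharp g θ X l := by
  have hgi := differentiableAt_gInv hg hdet
  have hpar := pdMatrix_gInv hsymm hg hdet k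
  have h1 : pd k (fun Y => sharp g θ Y i) X =
      (pdMatrix k (gInv g) X *ᵥ θ X) i + ∑ j, gInv g X i j * pd k (fun Y => θ Y j) X := by
    simp only [sharp]
    rw [pd_sum_mul _ (fun j Y => gInv g Y i j) (fun j Y => θ Y j) (hgi i) hθ]
    simp only [Matrix.mulVec, dotProduct, pdMatrix, Matrix.of_apply, ← Finset.sum_add_distrib]
  have h2 : ∑ l, christoffel g X i k l * sharp g θ X l
      = (connMatrix g X k *ᵥ (gInv g X *ᵥ θ X)) i := rfl
  have h3 : ∑ j, gInv g X i j * nabla g θ X k j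
      = ∑ j, gInv g X i j * pd k (fun Y => θ Y j) X
        - (gInv g X *ᵥ ((connMatrix g X k)ᵀ *ᵥ θ X)) i := by
    simp only [nabla, mul_sub, Finset.sum_sub_distrib]
    rfl
  rw [h1, h2, h3, hpar, Matrix.sub_mulVec, Matrix.neg_mulVec, Matrix.mulVec_mulVec,
    Matrix.mulVec_mulVec]
  simp only [Pi.sub_apply, Pi.neg_apply]
  ring

/-- `∂_k (θ^p θ_p) = 2 θ^p ∇_k θ_p`. -/
lemma pd_sharp_dot (hsymm : ∀ᶠ Y in 𝓝 X, (g Y).IsSymm)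
    (hg : ∀ i j, DifferentiableAt ℝ (fun Y => g Y i j) X) (hdet : IsUnit (g X).det)
    {θ : (Fin n → ℝ) → Fin n → ℝ} (hθ : ∀ i, DifferentiableAt ℝ (fun Y => θ Y i) X)
    (k : Fin n) :
    pd k (fun Y => ∑ p, sharp g θ Y p * θ Y p) X = 2 * ∑ p, sharp g θ X p * nabla g θ X k p := by
  have hgi := differentiableAt_gInv hg hdet
  have hs : ∀ p, DifferentiableAt ℝ (fun Y => sharp g θ Y p) X := fun p =>
    DifferentiableAt.fun_sum fun j _ => (hgi p j).mul (hθ j)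
  have hgs : ∀ i j, gInv g X i j = gInv g X j i := fun i j =>
    (Matrix.IsSymm.apply (hsymm.self_of_nhds.inv) j i)
  rw [pd_sum_mul _ (fun p Y => sharp g θ Y p) (fun p Y => θ Y p) hs hθ]
  have e : ∀ p, pd k (fun Y => sharp g θ Y p) X * θ X p + sharp g θ X p * pd k (fun Y => θ Y p) X =
      (∑ j, gInv g X p j * nabla g θ X k j) * θ X p
        - (∑ l, christoffel g X p k l * sharp g θ X l) * θ X p
        + sharp g θ X p * nabla g θ X k p
        + sharp g θ X p * ∑ l, christoffel g X l k p * θ X l := fun p => by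
    rw [pd_sharp hsymm hg hdet hθ]
    simp only [nabla]
    ring
  simp only [e, Finset.sum_add_distrib, Finset.sum_sub_distrib]
  have e1 : ∑ p, (∑ j, gInv g X p j * nabla g θ X k j) * θ X p
      = ∑ p, sharp g θ X p * nabla g θ X k p := by
    simp only [sharp, Finset.sum_mul]
    rw [Finset.sum_comm]
    refine Finset.sum_congr rfl fun i _ => Finset.sum_congr rfl fun j _ => ?_
    rw [hgs j i]
    ring
  have e2 : ∑ p, (∑ l, christoffel g X p k l * sharp g θ X l) * θ X p
      = ∑ p, sharp g θ X p * ∑ l, christoffel g X l k p * θ X l := by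
    simp only [Finset.sum_mul, Finset.mul_sum]
    rw [Finset.sum_comm]
    refine Finset.sum_congr rfl fun i _ => Finset.sum_congr rfl fun j _ => ?_
    ring
  rw [e1, e2]
  ring

/-- `∂_p θ^p + Γ^p_{pl} θ^l = ∇^p θ_p`. -/
lemma sum_pd_sharp (hsymm : ∀ᶠ Y in 𝓝 X, (g Y).IsSymm)
    (hg : ∀ i j, DifferentiableAt ℝ (fun Y => g Y i j) X) (hdet : IsUnit (g X).det)
    {θ : (Fin n → ℝ) → Fin n → ℝ} (hθ : ∀ i, DifferentiableAt ℝ (fun Y => θ Y i) X) :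
    ∑ p, pd p (fun Y => sharp g θ Y p) X + ∑ p, ∑ l, christoffel g X p p l * sharp g θ X l
      = divergence g θ X := by
  simp only [pd_sharp hsymm hg hdet hθ, Finset.sum_sub_distrib, divergence]
  rw [sub_add_cancel]

end LeviCivita

/-! ### Doubly warped metrics on a product of open sets -/

section Warped

variable {m : ℕ}

/-- The doubly warped metric `-β²(x) dt² + a²(t) γ_{μν}(x) dx^μ dx^ν` on coordinates `(t, x)`, with
all data given as functions on coordinate space. -/
def warpedMetric (a : ℝ → ℝ) (β : (Fin m → ℝ) → ℝ) (γ : (Fin m → ℝ) → Matrix (Fin m) (Fin m) ℝ)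
    (X : Fin (m + 1) → ℝ) : Matrix (Fin (m + 1)) (Fin (m + 1)) ℝ :=
  Matrix.of fun i j =>
    Fin.cases (Fin.cases (-β (Fin.tail X) ^ 2) (fun _ => 0) j)
      (fun μ => Fin.cases 0 (fun ν => a (X 0) ^ 2 * γ (Fin.tail X) μ ν) j) i

/-- The comoving covector `u_0 = -β`, `u_μ = 0`. -/
def comoving (β : (Fin m → ℝ) → ℝ) (X : Fin (m + 1) → ℝ) : Fin (m + 1) → ℝ :=
  Fin.cons (-β (Fin.tail X)) fun _ => 0

/-- The logarithmic gradient of the lapse, `q_μ = ∂_μ β / β`. -/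
def lapseGrad (β : (Fin m → ℝ) → ℝ) (x : Fin m → ℝ) (μ : Fin m) : ℝ :=
  pd μ β x / β x

/-- The logarithmic derivative of the scale factor, `a' / a`. -/
def hubble (a : ℝ → ℝ) (t : ℝ) : ℝ :=
  deriv a t / a t

/-- The regularity and nondegeneracy assumptions on the data of a doubly warped metric on the
coordinate domain `I × V`. The spatial metric only needs one derivative. -/
structure IsWarping (I : Set ℝ) (V : Set (Fin m → ℝ)) (a : ℝ → ℝ) (β : (Fin m → ℝ) → ℝ)
    (γ : (Fin m → ℝ) → Matrix (Fin m) (Fin m) ℝ) : Prop where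
  isOpen_time : IsOpen I
  isOpen_space : IsOpen V
  contDiffOn_scale : ContDiffOn ℝ 2 a I
  scale_ne : ∀ t ∈ I, a t ≠ 0
  contDiffOn_lapse : ContDiffOn ℝ 2 β V
  lapse_ne : ∀ x ∈ V, β x ≠ 0
  differentiableAt_space : ∀ x ∈ V, ∀ μ ν, DifferentiableAt ℝ (fun y => γ y μ ν) x
  isSymm_space : ∀ x ∈ V, (γ x).IsSymm
  isUnit_det_space : ∀ x ∈ V, IsUnit (γ x).det

/-- The coordinate domain `I × V`. -/
def warpedDomain (I : Set ℝ) (V : Set (Fin m → ℝ)) : Set (Fin (m + 1) → ℝ) :=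
  {X | X 0 ∈ I ∧ Fin.tail X ∈ V}

section Components

variable (a : ℝ → ℝ) (β : (Fin m → ℝ) → ℝ) (γ : (Fin m → ℝ) → Matrix (Fin m) (Fin m) ℝ)
  (X : Fin (m + 1) → ℝ) (μ ν : Fin m)

@[simp] lemma warpedMetric_zero_zero : warpedMetric a β γ X 0 0 = -β (Fin.tail X) ^ 2 := rfl

@[simp] lemma warpedMetric_zero_succ : warpedMetric a β γ X 0 μ.succ = 0 := rfl

@[simp] lemma warpedMetric_succ_zero : warpedMetric a β γ X μ.succ 0 = 0 := rfl

@[simp] lemma warpedMetric_succ_succ :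
    warpedMetric a β γ X μ.succ ν.succ = a (X 0) ^ 2 * γ (Fin.tail X) μ ν := rfl

@[simp] lemma comoving_zero : comoving β X 0 = -β (Fin.tail X) := rfl

@[simp] lemma comoving_succ : comoving β X μ.succ = 0 := rfl

end Components

section Pullback

variable {X : Fin (m + 1) → ℝ}

lemma hasFDerivAt_tail (X : Fin (m + 1) → ℝ) :
    HasFDerivAt (Fin.tail : (Fin (m + 1) → ℝ) → Fin m → ℝ)
      (ContinuousLinearMap.pi fun μ : Fin m => ContinuousLinearMap.proj (R := ℝ)
        (φ := fun _ : Fin (m + 1) => ℝ) μ.succ) X :=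
  (ContinuousLinearMap.pi fun μ : Fin m => ContinuousLinearMap.proj (R := ℝ)
        (φ := fun _ : Fin (m + 1) => ℝ) μ.succ).hasFDerivAt

lemma differentiableAt_comp_tail {h : (Fin m → ℝ) → ℝ} (hh : DifferentiableAt ℝ h (Fin.tail X)) :
    DifferentiableAt ℝ (fun Y : Fin (m + 1) → ℝ => h (Fin.tail Y)) X :=
  hh.comp X (hasFDerivAt_tail X).differentiableAt

lemma differentiableAt_comp_time {f : ℝ → ℝ} (hf : DifferentiableAt ℝ f (X 0)) :
    DifferentiableAt ℝ (fun Y : Fin (m + 1) → ℝ => f (Y 0)) X :=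
  hf.comp X (differentiableAt_apply 0 X)

/-- A function of the space coordinates alone has no time derivative. No differentiability is
needed: where `fderiv` is the junk value `0`, the claim still holds. -/
lemma pd_zero_comp_tail (h : (Fin m → ℝ) → ℝ) :
    pd 0 (fun Y : Fin (m + 1) → ℝ => h (Fin.tail Y)) X = 0 := by
  by_cases hd : DifferentiableAt ℝ (fun Y : Fin (m + 1) → ℝ => h (Fin.tail Y)) X
  · rw [pd, ← hd.lineDeriv_eq_fderiv, lineDeriv]
    have : (fun t : ℝ => h (Fin.tail (X + t • Pi.single (0 : Fin (m + 1)) (1 : ℝ))))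
        = fun _ => h (Fin.tail X) := by
      funext t
      congr 1
      funext μ
      simp [Fin.tail]
    rw [this]
    simp
  · simp [pd, fderiv_zero_of_not_differentiableAt hd]

lemma pd_succ_comp_tail {h : (Fin m → ℝ) → ℝ} (hh : DifferentiableAt ℝ h (Fin.tail X))
    (μ : Fin m) :
    pd μ.succ (fun Y : Fin (m + 1) → ℝ => h (Fin.tail Y)) X = pd μ h (Fin.tail X) := by
  have h1 := (hh.hasFDerivAt.comp X (hasFDerivAt_tail X)).fderiv
  rw [pd, pd, show (fun Y : Fin (m + 1) → ℝ => h (Fin.tail Y)) = h ∘ Fin.tail from rfl, h1]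
  simp only [ContinuousLinearMap.comp_apply]
  congr 1
  funext ν
  simp [Pi.single_apply]

lemma pd_zero_comp_time {f : ℝ → ℝ} (hf : DifferentiableAt ℝ f (X 0)) :
    pd 0 (fun Y : Fin (m + 1) → ℝ => f (Y 0)) X = deriv f (X 0) := by
  have h1 := (hf.hasFDerivAt.comp X (hasFDerivAt_apply (𝕜 := ℝ) (0 : Fin (m + 1)) X)).fderiv
  rw [pd, show (fun Y : Fin (m + 1) → ℝ => f (Y 0)) = f ∘ fun Y => Y 0 from rfl, h1]
  simp

lemma pd_succ_comp_time {f : ℝ → ℝ} (hf : DifferentiableAt ℝ f (X 0)) (μ : Fin m) :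
    pd μ.succ (fun Y : Fin (m + 1) → ℝ => f (Y 0)) X = 0 := by
  have h1 := (hf.hasFDerivAt.comp X (hasFDerivAt_apply (𝕜 := ℝ) (0 : Fin (m + 1)) X)).fderiv
  rw [pd, show (fun Y : Fin (m + 1) → ℝ => f (Y 0)) = f ∘ fun Y => Y 0 from rfl, h1]
  simp

end Pullback

lemma pd_zero_metric_zero_zero (a : ℝ → ℝ) (β : (Fin m → ℝ) → ℝ)
    (γ : (Fin m → ℝ) → Matrix (Fin m) (Fin m) ℝ) (X : Fin (m + 1) → ℝ) :
    pd 0 (fun Y => warpedMetric a β γ Y 0 0) X = 0 :=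
  pd_zero_comp_tail fun x => -β x ^ 2

namespace IsWarping

variable {I : Set ℝ} {V : Set (Fin m → ℝ)} {a : ℝ → ℝ} {β : (Fin m → ℝ) → ℝ}
  {γ : (Fin m → ℝ) → Matrix (Fin m) (Fin m) ℝ} (hw : IsWarping I V a β γ)
  {X : Fin (m + 1) → ℝ} (hX : X ∈ warpedDomain I V)

include hw hX

lemma mem_nhds : warpedDomain I V ∈ 𝓝 X := by
  refine IsOpen.mem_nhds ?_ hX
  exact (hw.isOpen_time.preimage (continuous_apply 0)).inter
    (hw.isOpen_space.preimage (by unfold Fin.tail; fun_prop))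

lemma scale_ne_zero : a (X 0) ≠ 0 := hw.scale_ne _ hX.1

lemma lapse_ne_zero : β (Fin.tail X) ≠ 0 := hw.lapse_ne _ hX.2

lemma differentiableAt_scale : DifferentiableAt ℝ a (X 0) :=
  (hw.contDiffOn_scale.contDiffAt (hw.isOpen_time.mem_nhds hX.1)).differentiableAt (by simp)

lemma differentiableAt_deriv_scale : DifferentiableAt ℝ (deriv a) (X 0) :=
  ((hw.contDiffOn_scale.contDiffAt (hw.isOpen_time.mem_nhds hX.1)).derivWithin
    (m := 1) (by norm_num)).differentiableAt (by simp)

lemma differentiableAt_lapse : DifferentiableAt ℝ β (Fin.tail X) :=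
  (hw.contDiffOn_lapse.contDiffAt (hw.isOpen_space.mem_nhds hX.2)).differentiableAt (by simp)

lemma differentiableAt_pd_lapse (μ : Fin m) : DifferentiableAt ℝ (pd μ β) (Fin.tail X) :=
  (((hw.contDiffOn_lapse.contDiffAt (hw.isOpen_space.mem_nhds hX.2)).fderiv_right
    (m := 1) (by norm_num)).differentiableAt (by simp)).clm_apply (differentiableAt_const _)

lemma differentiableAt_lapseGrad (μ : Fin m) :
    DifferentiableAt ℝ (fun x => lapseGrad β x μ) (Fin.tail X) := by
  simp only [lapseGrad, div_eq_mul_inv]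
  exact (hw.differentiableAt_pd_lapse hX μ).mul
    ((hw.differentiableAt_lapse hX).inv (hw.lapse_ne_zero hX))

lemma differentiableAt_hubble : DifferentiableAt ℝ (hubble a) (X 0) := by
  unfold hubble
  simp only [div_eq_mul_inv]
  exact (hw.differentiableAt_deriv_scale hX).mul
    ((hw.differentiableAt_scale hX).inv (hw.scale_ne_zero hX))

lemma differentiableAt_metric (i j : Fin (m + 1)) :
    DifferentiableAt ℝ (fun Y => warpedMetric a β γ Y i j) X := by
  refine Fin.cases ?_ (fun μ => ?_) i <;> refine Fin.cases ?_ (fun ν => ?_) j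
  · exact ((differentiableAt_comp_tail (hw.differentiableAt_lapse hX)).pow 2).neg
  · exact differentiableAt_const _
  · exact differentiableAt_const _
  · exact ((differentiableAt_comp_time (hw.differentiableAt_scale hX)).pow 2).mul
      (differentiableAt_comp_tail (hw.differentiableAt_space _ hX.2 μ ν))

lemma isSymm_metric : (warpedMetric a β γ X).IsSymm := by
  refine Matrix.IsSymm.ext fun i j => ?_
  refine Fin.cases ?_ (fun μ => ?_) i <;> refine Fin.cases ?_ (fun ν => ?_) j
  · rfl
  · rfl
  · rfl
  · simp [(hw.isSymm_space _ hX.2).apply μ ν]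

lemma eventually_isSymm : ∀ᶠ Y in 𝓝 X, (warpedMetric a β γ Y).IsSymm := by
  filter_upwards [hw.mem_nhds hX] with Y hY
  exact hw.isSymm_metric hY

/-- The block-diagonal inverse `diag(-1/β², γ⁻¹/a²)`. -/
lemma metric_mul_inverse :
    warpedMetric a β γ X * (Matrix.of fun i j =>
      Fin.cases (Fin.cases (-1 / β (Fin.tail X) ^ 2) (fun _ => 0) j)
        (fun μ => Fin.cases 0 (fun ν => (γ (Fin.tail X))⁻¹ μ ν / a (X 0) ^ 2) j) i) = 1 := by
  have hβ := hw.lapse_ne_zero hX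
  have ha := hw.scale_ne_zero hX
  ext i j
  rw [Matrix.mul_apply, Fin.sum_univ_succ]
  refine Fin.cases ?_ (fun μ => ?_) i <;> refine Fin.cases ?_ (fun ν => ?_) j
  · simp
    field_simp
  · simp [(Fin.succ_ne_zero ν).symm]
  · simp
  · have := congrFun (congrFun (Matrix.mul_nonsing_inv _ (hw.isUnit_det_space _ hX.2)) μ) ν
    rw [Matrix.mul_apply] at this
    simp only [warpedMetric_succ_zero, zero_mul, warpedMetric_succ_succ, Matrix.of_apply,
      Fin.cases_succ, zero_add, Matrix.one_apply, Fin.succ_inj] at this ⊢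
    rw [← this]
    refine Finset.sum_congr rfl fun ρ _ => ?_
    field_simp

lemma isUnit_det : IsUnit (warpedMetric a β γ X).det :=
  Matrix.isUnit_det_of_right_inverse (hw.metric_mul_inverse hX)

lemma gInv_zero_zero : gInv (warpedMetric a β γ) X 0 0 = -1 / β (Fin.tail X) ^ 2 := by
  rw [gInv, Matrix.inv_eq_right_inv (hw.metric_mul_inverse hX)]
  rfl

lemma gInv_zero_succ (μ : Fin m) : gInv (warpedMetric a β γ) X 0 μ.succ = 0 := by
  rw [gInv, Matrix.inv_eq_right_inv (hw.metric_mul_inverse hX)]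
  rfl

lemma gInv_succ_zero (μ : Fin m) : gInv (warpedMetric a β γ) X μ.succ 0 = 0 := by
  rw [gInv, Matrix.inv_eq_right_inv (hw.metric_mul_inverse hX)]
  rfl

lemma gInv_succ_succ (μ ν : Fin m) : gInv (warpedMetric a β γ) X μ.succ ν.succ
    = gInv γ (Fin.tail X) μ ν / a (X 0) ^ 2 := by
  rw [gInv, Matrix.inv_eq_right_inv (hw.metric_mul_inverse hX)]
  rfl

lemma sum_gInv_space (μ ν : Fin m) :
    ∑ l, gInv γ (Fin.tail X) μ l * γ (Fin.tail X) l ν = if μ = ν then 1 else 0 := by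
  rw [← Matrix.one_apply, ← Matrix.nonsing_inv_mul _ (hw.isUnit_det_space _ hX.2),
    Matrix.mul_apply]
  rfl

lemma pd_succ_metric_zero_zero (μ : Fin m) : pd μ.succ (fun Y => warpedMetric a β γ Y 0 0) X
    = -2 * β (Fin.tail X) * pd μ β (Fin.tail X) := by
  have hβ := hw.differentiableAt_lapse hX
  have hβ2 : DifferentiableAt ℝ (fun x => -(β x * β x)) (Fin.tail X) := (hβ.mul hβ).neg
  have h : pd μ.succ (fun Y => warpedMetric a β γ Y 0 0) X
      = pd μ (fun x => -(β x * β x)) (Fin.tail X) := by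
    rw [← pd_succ_comp_tail hβ2]
    simp [sq]
  rw [h, pd_neg, pd_mul hβ hβ]
  ring

lemma pd_zero_metric_succ_succ (μ ν : Fin m) :
    pd 0 (fun Y => warpedMetric a β γ Y μ.succ ν.succ) X
      = 2 * a (X 0) * deriv a (X 0) * γ (Fin.tail X) μ ν := by
  have ha := differentiableAt_comp_time (hw.differentiableAt_scale hX)
  have ha2 : DifferentiableAt ℝ (fun Y : Fin (m + 1) → ℝ => a (Y 0) * a (Y 0)) X := ha.mul ha
  have hγ := differentiableAt_comp_tail (hw.differentiableAt_space _ hX.2 μ ν)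
  simp only [warpedMetric_succ_succ, sq]
  rw [pd_mul ha2 hγ, pd_mul ha ha, pd_zero_comp_time (hw.differentiableAt_scale hX),
    pd_zero_comp_tail fun x => γ x μ ν]
  ring

lemma pd_succ_metric_succ_succ (ρ μ ν : Fin m) :
    pd ρ.succ (fun Y => warpedMetric a β γ Y μ.succ ν.succ) X
      = a (X 0) ^ 2 * pd ρ (fun x => γ x μ ν) (Fin.tail X) := by
  have ha := differentiableAt_comp_time (hw.differentiableAt_scale hX)
  have ha2 : DifferentiableAt ℝ (fun Y : Fin (m + 1) → ℝ => a (Y 0) * a (Y 0)) X := ha.mul ha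
  have hγ := differentiableAt_comp_tail (hw.differentiableAt_space _ hX.2 μ ν)
  simp only [warpedMetric_succ_succ, sq]
  rw [pd_mul ha2 hγ, pd_mul ha ha, pd_succ_comp_time (hw.differentiableAt_scale hX),
    pd_succ_comp_tail (hw.differentiableAt_space _ hX.2 μ ν)]
  ring

/-! ### The Christoffel symbols of a doubly warped metric -/

lemma christoffel_swap (k i j : Fin (m + 1)) :
    christoffel (warpedMetric a β γ) X k i j = christoffel (warpedMetric a β γ) X k j i :=
  christoffel_symm (hw.eventually_isSymm hX) k i j

lemma christoffel_zero_zero_zero : christoffel (warpedMetric a β γ) X 0 0 0 = 0 := by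
  rw [christoffel, Fin.sum_univ_succ]
  simp only [hw.gInv_zero_succ hX, pd_zero_metric_zero_zero]
  simp

lemma christoffel_zero_zero_succ (μ : Fin m) :
    christoffel (warpedMetric a β γ) X 0 0 μ.succ = lapseGrad β (Fin.tail X) μ := by
  have hβ := hw.lapse_ne_zero hX
  rw [christoffel, Fin.sum_univ_succ]
  simp only [hw.gInv_zero_succ hX, hw.gInv_zero_zero hX, warpedMetric_succ_zero,
    hw.pd_succ_metric_zero_zero hX, pd_const, warpedMetric_zero_succ, lapseGrad]
  field_simp
  simp

lemma christoffel_zero_succ_zero (μ : Fin m) :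
    christoffel (warpedMetric a β γ) X 0 μ.succ 0 = lapseGrad β (Fin.tail X) μ := by
  rw [hw.christoffel_swap hX, hw.christoffel_zero_zero_succ hX]

lemma christoffel_zero_succ_succ (μ ν : Fin m) :
    christoffel (warpedMetric a β γ) X 0 μ.succ ν.succ
      = hubble a (X 0) / β (Fin.tail X) ^ 2 * warpedMetric a β γ X μ.succ ν.succ := by
  have hβ := hw.lapse_ne_zero hX
  have ha := hw.scale_ne_zero hX
  rw [christoffel, Fin.sum_univ_succ]
  simp only [hw.gInv_zero_succ hX, hw.gInv_zero_zero hX, warpedMetric_succ_zero,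
    hw.pd_zero_metric_succ_succ hX, pd_const, hubble]
  simp only [warpedMetric_succ_succ]
  field_simp
  simp

lemma christoffel_succ_zero_zero (μ : Fin m) :
    christoffel (warpedMetric a β γ) X μ.succ 0 0
      = β (Fin.tail X) ^ 2 * ∑ ν, gInv (warpedMetric a β γ) X μ.succ ν.succ
          * lapseGrad β (Fin.tail X) ν := by
  have hβ := hw.lapse_ne_zero hX
  rw [christoffel, Fin.sum_univ_succ]
  simp only [hw.gInv_succ_zero hX, warpedMetric_zero_succ, hw.pd_succ_metric_zero_zero hX,
    pd_const, zero_mul, zero_add, Finset.mul_sum, lapseGrad]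
  refine Finset.sum_congr rfl fun ν _ => ?_
  field_simp
  ring

lemma christoffel_succ_zero_succ (μ ν : Fin m) :
    christoffel (warpedMetric a β γ) X μ.succ 0 ν.succ
      = if μ = ν then hubble a (X 0) else 0 := by
  have ha := hw.scale_ne_zero hX
  rw [christoffel, Fin.sum_univ_succ]
  simp only [hw.gInv_succ_zero hX, hw.gInv_succ_succ hX, warpedMetric_zero_succ, pd_const,
    hw.pd_zero_metric_succ_succ hX, zero_mul, zero_add, add_zero, sub_zero]
  have h : ∀ l, gInv γ (Fin.tail X) μ l / a (X 0) ^ 2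
      * (2 * a (X 0) * deriv a (X 0) * γ (Fin.tail X) ν l)
      = (2 * deriv a (X 0) / a (X 0)) * (gInv γ (Fin.tail X) μ l * γ (Fin.tail X) l ν) := by
    intro l
    rw [(hw.isSymm_space _ hX.2).apply l ν]
    field_simp
  simp only [h, ← Finset.mul_sum, hw.sum_gInv_space hX]
  split_ifs
  · simp only [hubble]
    ring
  · simp

lemma christoffel_succ_succ_zero (μ ν : Fin m) :
    christoffel (warpedMetric a β γ) X μ.succ ν.succ 0
      = if μ = ν then hubble a (X 0) else 0 := by
  rw [hw.christoffel_swap hX, hw.christoffel_succ_zero_succ hX]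

/-- The purely spatial Christoffel symbols are those of `γ`: the factor `a²` cancels. -/
lemma christoffel_succ_succ_succ (ρ μ ν : Fin m) :
    christoffel (warpedMetric a β γ) X ρ.succ μ.succ ν.succ
      = christoffel γ (Fin.tail X) ρ μ ν := by
  have ha := hw.scale_ne_zero hX
  rw [christoffel, christoffel, Fin.sum_univ_succ]
  simp only [hw.gInv_succ_zero hX, hw.gInv_succ_succ hX, hw.pd_succ_metric_succ_succ hX,
    zero_mul, zero_add]
  congr 1
  refine Finset.sum_congr rfl fun l _ => ?_
  field_simp

end IsWarping

end Warped

/-! ### Kinematics of the comoving observer -/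

lemma pd_comm {n : ℕ} {f : (Fin n → ℝ) → ℝ} {x : Fin n → ℝ} (hf : ContDiffAt ℝ 2 f x)
    (i j : Fin n) : pd i (pd j f) x = pd j (pd i f) x := by
  have hd : DifferentiableAt ℝ (fderiv ℝ f) x :=
    (hf.fderiv_right (m := 1) (by norm_num)).differentiableAt (by simp)
  have h : ∀ k l : Fin n, pd k (pd l f) x
      = fderiv ℝ (fderiv ℝ f) x (Pi.single k 1) (Pi.single l 1) := by
    intro k l
    change fderiv ℝ (fun y => fderiv ℝ f y (Pi.single l 1)) x (Pi.single k 1) = _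
    rw [fderiv_clm_apply hd (differentiableAt_const _)]
    simp
  rw [h, h]
  exact hf.isSymmSndFDerivAt (by simp) _ _

lemma nabla_comoving {m : ℕ} (g : (Fin (m + 1) → ℝ) → Matrix (Fin (m + 1)) (Fin (m + 1)) ℝ)
    (β : (Fin m → ℝ) → ℝ) (X : Fin (m + 1) → ℝ) (i j : Fin (m + 1)) :
    nabla g (comoving β) X i j =
      pd i (fun Y => comoving β Y j) X + β (Fin.tail X) * christoffel g X 0 i j := by
  rw [nabla, Fin.sum_univ_succ]
  simp
  ring

lemma riemann_self_self {n : ℕ} (g : (Fin n → ℝ) → Matrix (Fin n) (Fin n) ℝ) (X : Fin n → ℝ)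
    (j l k : Fin n) : riemann g X j j l k = 0 := by
  simp [riemann]

namespace IsWarping

variable {m : ℕ} {I : Set ℝ} {V : Set (Fin m → ℝ)} {a : ℝ → ℝ} {β : (Fin m → ℝ) → ℝ}
  {γ : (Fin m → ℝ) → Matrix (Fin m) (Fin m) ℝ} (hw : IsWarping I V a β γ)
  {X : Fin (m + 1) → ℝ} (hX : X ∈ warpedDomain I V)

include hw hX

local notation "𝔤" => warpedMetric a β γ
local notation "𝔲" => comoving β

lemma gInv_symm (i j : Fin (m + 1)) : gInv 𝔤 X i j = gInv 𝔤 X j i :=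
  Matrix.IsSymm.apply (hw.isSymm_metric hX).inv j i

lemma sharp_zero (θ : (Fin (m + 1) → ℝ) → Fin (m + 1) → ℝ) :
    sharp 𝔤 θ X 0 = -θ X 0 / β (Fin.tail X) ^ 2 := by
  rw [sharp, Fin.sum_univ_succ]
  simp only [hw.gInv_zero_zero hX, hw.gInv_zero_succ hX]
  simp
  ring

lemma sharp_succ (θ : (Fin (m + 1) → ℝ) → Fin (m + 1) → ℝ) (μ : Fin m) :
    sharp 𝔤 θ X μ.succ = ∑ ν : Fin m, gInv 𝔤 X μ.succ ν.succ * θ X ν.succ := by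
  rw [sharp, Fin.sum_univ_succ]
  simp only [hw.gInv_succ_zero hX]
  simp

lemma sharp_comoving_zero : sharp 𝔤 𝔲 X 0 = 1 / β (Fin.tail X) := by
  have hβ := hw.lapse_ne_zero hX
  rw [hw.sharp_zero hX]
  simp only [comoving_zero]
  field_simp

lemma sharp_comoving_succ (μ : Fin m) : sharp 𝔤 𝔲 X μ.succ = 0 := by
  simp [hw.sharp_succ hX]

lemma nabla_comoving_zero_zero : nabla 𝔤 𝔲 X 0 0 = 0 := by
  rw [nabla_comoving, hw.christoffel_zero_zero_zero hX, mul_zero, add_zero]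
  exact pd_zero_comp_tail fun x => -β x

lemma nabla_comoving_zero_succ (μ : Fin m) :
    nabla 𝔤 𝔲 X 0 μ.succ = β (Fin.tail X) * lapseGrad β (Fin.tail X) μ := by
  rw [nabla_comoving, hw.christoffel_zero_zero_succ hX]
  simp [pd_const]

lemma nabla_comoving_succ_succ (μ ν : Fin m) :
    nabla 𝔤 𝔲 X μ.succ ν.succ
      = hubble a (X 0) / β (Fin.tail X) * 𝔤 X μ.succ ν.succ := by
  have hβ := hw.lapse_ne_zero hX
  rw [nabla_comoving, hw.christoffel_zero_succ_succ hX]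
  simp only [comoving_succ, pd_const]
  field_simp
  ring

lemma accel_zero : accel 𝔤 𝔲 X 0 = 0 := by
  rw [accel, Fin.sum_univ_succ, hw.nabla_comoving_zero_zero hX]
  simp [hw.sharp_comoving_succ hX]

lemma accel_succ (μ : Fin m) : accel 𝔤 𝔲 X μ.succ = lapseGrad β (Fin.tail X) μ := by
  have hβ := hw.lapse_ne_zero hX
  rw [accel, Fin.sum_univ_succ, hw.nabla_comoving_zero_succ hX, hw.sharp_comoving_zero hX]
  simp only [hw.sharp_comoving_succ hX]
  field_simp
  simp

lemma sharp_accel_zero : sharp 𝔤 (accel 𝔤 𝔲) X 0 = 0 := by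
  simp [hw.sharp_zero hX, hw.accel_zero hX]

lemma eventually_accel_zero : (fun Y => accel 𝔤 𝔲 Y 0) =ᶠ[𝓝 X] fun _ => 0 := by
  filter_upwards [hw.mem_nhds hX] with Y hY using hw.accel_zero hY

lemma eventually_accel_succ (μ : Fin m) : (fun Y => accel 𝔤 𝔲 Y μ.succ)
    =ᶠ[𝓝 X] fun Y => lapseGrad β (Fin.tail Y) μ := by
  filter_upwards [hw.mem_nhds hX] with Y hY using hw.accel_succ hY μ

lemma differentiableAt_accel (i : Fin (m + 1)) :
    DifferentiableAt ℝ (fun Y => accel 𝔤 𝔲 Y i) X := by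
  refine Fin.cases ?_ (fun μ => ?_) i
  · exact (differentiableAt_const _).congr_of_eventuallyEq (hw.eventually_accel_zero hX)
  · exact (differentiableAt_comp_tail (hw.differentiableAt_lapseGrad hX μ)).congr_of_eventuallyEq
      (hw.eventually_accel_succ hX μ)

/-- `Γ^p_{00} = β² u̇^p`. -/
lemma christoffel_time_time (p : Fin (m + 1)) :
    christoffel 𝔤 X p 0 0 = β (Fin.tail X) ^ 2 * sharp 𝔤 (accel 𝔤 𝔲) X p := by
  refine Fin.cases ?_ (fun μ => ?_) p
  · rw [hw.christoffel_zero_zero_zero hX, hw.sharp_accel_zero hX, mul_zero]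
  · rw [hw.christoffel_succ_zero_zero hX, hw.sharp_succ hX]
    simp only [hw.accel_succ hX]

lemma eta_eq_sum : eta 𝔤 𝔲 X
    = ∑ μ : Fin m, sharp 𝔤 (accel 𝔤 𝔲) X μ.succ * lapseGrad β (Fin.tail X) μ := by
  rw [eta, Fin.sum_univ_succ, hw.accel_zero hX]
  simp only [hw.accel_succ hX]
  simp

lemma pd_lapseGrad_symm (μ ν : Fin m) :
    pd μ (fun x => lapseGrad β x ν) (Fin.tail X) = pd ν (fun x => lapseGrad β x μ) (Fin.tail X) := by
  have hβ := hw.differentiableAt_lapse hX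
  have h0 := hw.lapse_ne_zero hX
  simp only [lapseGrad]
  rw [pd_div (hw.differentiableAt_pd_lapse hX ν) hβ h0,
    pd_div (hw.differentiableAt_pd_lapse hX μ) hβ h0,
    pd_comm (hw.contDiffOn_lapse.contDiffAt (hw.isOpen_space.mem_nhds hX.2)) μ ν]
  ring

/-- The covariant gradient of the acceleration, written out. -/
lemma nabla_accel (i j : Fin (m + 1)) :
    nabla 𝔤 (accel 𝔤 𝔲) X i j = pd i (fun Y => accel 𝔤 𝔲 Y j) X
      - ∑ ρ : Fin m, christoffel 𝔤 X ρ.succ i j * lapseGrad β (Fin.tail X) ρ := by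
  rw [nabla, Fin.sum_univ_succ, hw.accel_zero hX]
  simp only [hw.accel_succ hX]
  simp

lemma pd_accel_zero (i : Fin (m + 1)) : pd i (fun Y => accel 𝔤 𝔲 Y 0) X = 0 := by
  rw [pd_congr (hw.eventually_accel_zero hX), pd_const]

lemma pd_zero_accel_succ (μ : Fin m) : pd 0 (fun Y => accel 𝔤 𝔲 Y μ.succ) X = 0 := by
  rw [pd_congr (hw.eventually_accel_succ hX μ)]
  exact pd_zero_comp_tail fun x => lapseGrad β x μ

lemma pd_succ_accel_succ (μ ν : Fin m) : pd μ.succ (fun Y => accel 𝔤 𝔲 Y ν.succ) X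
    = pd μ (fun x => lapseGrad β x ν) (Fin.tail X) := by
  rw [pd_congr (hw.eventually_accel_succ hX ν)]
  exact pd_succ_comp_tail (hw.differentiableAt_lapseGrad hX ν) μ

/-- The acceleration is a closed one-form, so its covariant gradient is symmetric. -/
lemma nabla_accel_symm (i j : Fin (m + 1)) :
    nabla 𝔤 (accel 𝔤 𝔲) X i j = nabla 𝔤 (accel 𝔤 𝔲) X j i := by
  have hpd : pd i (fun Y => accel 𝔤 𝔲 Y j) X = pd j (fun Y => accel 𝔤 𝔲 Y i) X := by
    refine Fin.cases ?_ (fun μ => ?_) i <;> refine Fin.cases ?_ (fun ν => ?_) j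
    · rfl
    · rw [hw.pd_zero_accel_succ hX, hw.pd_accel_zero hX]
    · rw [hw.pd_zero_accel_succ hX, hw.pd_accel_zero hX]
    · rw [hw.pd_succ_accel_succ hX, hw.pd_succ_accel_succ hX, hw.pd_lapseGrad_symm hX]
  rw [hw.nabla_accel hX, hw.nabla_accel hX, hpd]
  simp only [hw.christoffel_swap hX _ i j]

lemma nabla_accel_zero_zero :
    nabla 𝔤 (accel 𝔤 𝔲) X 0 0 = -β (Fin.tail X) ^ 2 * eta 𝔤 𝔲 X := by
  rw [hw.nabla_accel hX, hw.pd_accel_zero hX, hw.eta_eq_sum hX]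
  simp only [hw.christoffel_time_time hX, Finset.mul_sum, zero_sub, ← Finset.sum_neg_distrib]
  exact Finset.sum_congr rfl fun _ _ => by ring

/-- `∂_k η = 2 u̇^p ∇_k u̇_p`. -/
lemma pd_eta (k : Fin (m + 1)) : pd k (eta 𝔤 𝔲) X
    = 2 * ∑ p, sharp 𝔤 (accel 𝔤 𝔲) X p * nabla 𝔤 (accel 𝔤 𝔲) X k p :=
  pd_sharp_dot (hw.eventually_isSymm hX) (hw.differentiableAt_metric hX) (hw.isUnit_det hX)
    (hw.differentiableAt_accel hX) k

/-- The trace of the identity on the `m` space directions. -/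
lemma sum_gInv_mul_metric :
    ∑ μ : Fin m, ∑ ν : Fin m, gInv 𝔤 X μ.succ ν.succ * 𝔤 X μ.succ ν.succ = m := by
  have ha := hw.scale_ne_zero hX
  have h : ∀ μ : Fin m, ∑ ν : Fin m, gInv 𝔤 X μ.succ ν.succ * 𝔤 X μ.succ ν.succ = 1 := by
    intro μ
    rw [← if_pos (rfl : μ = μ) (c := μ = μ) (t := (1 : ℝ)) (e := 0), ← hw.sum_gInv_space hX μ μ]
    refine Finset.sum_congr rfl fun ν _ => ?_
    rw [hw.gInv_succ_succ hX, warpedMetric_succ_succ, (hw.isSymm_space _ hX.2).apply ν μ]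
    field_simp
  simp only [h, Finset.sum_const, Finset.card_univ, Fintype.card_fin, nsmul_eq_mul, mul_one]

lemma divergence_eq (θ : (Fin (m + 1) → ℝ) → Fin (m + 1) → ℝ) :
    divergence 𝔤 θ X = -1 / β (Fin.tail X) ^ 2 * nabla 𝔤 θ X 0 0
      + ∑ μ : Fin m, ∑ ν : Fin m, gInv 𝔤 X μ.succ ν.succ * nabla 𝔤 θ X μ.succ ν.succ := by
  rw [divergence, Fin.sum_univ_succ]
  simp only [Fin.sum_univ_succ (n := m), hw.gInv_zero_zero hX, hw.gInv_zero_succ hX,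
    hw.gInv_succ_zero hX]
  simp

lemma divergence_comoving :
    divergence 𝔤 𝔲 X = m * (hubble a (X 0) / β (Fin.tail X)) := by
  rw [hw.divergence_eq hX, hw.nabla_comoving_zero_zero hX, ← hw.sum_gInv_mul_metric hX]
  simp only [hw.nabla_comoving_succ_succ hX, mul_zero, zero_add, Finset.sum_mul]
  exact Finset.sum_congr rfl fun _ _ => Finset.sum_congr rfl fun _ _ => by ring

lemma expansion_eq (hm : m ≠ 0) :
    expansion 𝔤 𝔲 X = hubble a (X 0) / β (Fin.tail X) := by
  have : (m : ℝ) ≠ 0 := Nat.cast_ne_zero.2 hm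
  rw [expansion, hw.divergence_comoving hX, Nat.cast_add, Nat.cast_one, add_sub_cancel_right]
  field_simp

lemma xi_eq (hm : m ≠ 0) :
    xi 𝔤 𝔲 X = m * (hubble a (X 0) ^ 2 + deriv (hubble a) (X 0)) / β (Fin.tail X) ^ 2 := by
  have hβ := hw.lapse_ne_zero hX
  have hev : expansion 𝔤 𝔲 =ᶠ[𝓝 X] fun Y => hubble a (Y 0) * (β (Fin.tail Y))⁻¹ := by
    filter_upwards [hw.mem_nhds hX] with Y hY
    rw [hw.expansion_eq hY hm, div_eq_mul_inv]
  have hpd : pd 0 (expansion 𝔤 𝔲) X = deriv (hubble a) (X 0) / β (Fin.tail X) := by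
    rw [pd_congr hev, pd_mul (differentiableAt_comp_time (hw.differentiableAt_hubble hX))
      (differentiableAt_comp_tail (h := fun x => (β x)⁻¹)
        ((hw.differentiableAt_lapse hX).inv hβ)),
      pd_zero_comp_time (hw.differentiableAt_hubble hX), pd_zero_comp_tail fun x => (β x)⁻¹]
    ring
  have hs : scalarAlong 𝔤 𝔲 (expansion 𝔤 𝔲) X
      = deriv (hubble a) (X 0) / β (Fin.tail X) ^ 2 := by
    rw [scalarAlong, Fin.sum_univ_succ, hw.sharp_comoving_zero hX, hpd]
    simp only [hw.sharp_comoving_succ hX]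
    field_simp
    simp
  rw [xi, hs, hw.expansion_eq hX hm]
  push_cast
  field_simp
  ring

/-! ### Curvature components along the comoving observer -/

lemma pd_zero_christoffel_zero_succ_succ (μ ν : Fin m) :
    pd 0 (fun Y => christoffel 𝔤 Y 0 μ.succ ν.succ) X
      = (deriv (hubble a) (X 0) + 2 * hubble a (X 0) ^ 2) / β (Fin.tail X) ^ 2
          * 𝔤 X μ.succ ν.succ := by
  have ha := hw.scale_ne_zero hX
  have hβ := hw.lapse_ne_zero hX
  have hH := differentiableAt_comp_time (hw.differentiableAt_hubble hX)
  have hβi : DifferentiableAt ℝ (fun x => (β x * β x)⁻¹) (Fin.tail X) :=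
    ((hw.differentiableAt_lapse hX).mul (hw.differentiableAt_lapse hX)).inv (mul_ne_zero hβ hβ)
  have hev : (fun Y => christoffel 𝔤 Y 0 μ.succ ν.succ) =ᶠ[𝓝 X]
      fun Y => hubble a (Y 0) * ((β (Fin.tail Y) * β (Fin.tail Y))⁻¹ * 𝔤 Y μ.succ ν.succ) := by
    filter_upwards [hw.mem_nhds hX] with Y hY
    rw [hw.christoffel_zero_succ_succ hY, sq]
    ring
  have hd : DifferentiableAt ℝ
      (fun Y => (β (Fin.tail Y) * β (Fin.tail Y))⁻¹ * 𝔤 Y μ.succ ν.succ) X :=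
    (differentiableAt_comp_tail hβi).mul (hw.differentiableAt_metric hX _ _)
  rw [pd_congr hev, pd_mul hH hd,
    pd_mul (differentiableAt_comp_tail hβi) (hw.differentiableAt_metric hX _ _),
    pd_zero_comp_tail fun x => (β x * β x)⁻¹, pd_zero_comp_time (hw.differentiableAt_hubble hX),
    hw.pd_zero_metric_succ_succ hX]
  simp only [warpedMetric_succ_succ]
  have : deriv a (X 0) = hubble a (X 0) * a (X 0) := by
    rw [hubble]
    field_simp
  rw [this]
  field_simp
  ring

lemma eventually_christoffel_zero_zero_succ (μ : Fin m) :
    (fun Y => christoffel 𝔤 Y 0 0 μ.succ) =ᶠ[𝓝 X] fun Y => lapseGrad β (Fin.tail Y) μ := by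
  filter_upwards [hw.mem_nhds hX] with Y hY using hw.christoffel_zero_zero_succ hY μ

/-- The tidal tensor of the comoving observer: `-u^j u^m R_{jμνm}`, computed from the connection
without any knowledge of the curvature of `γ`. -/
lemma riemann_zero_succ_succ_zero (hm : m ≠ 0) (μ ν : Fin m) :
    riemann 𝔤 X 0 μ.succ ν.succ 0 = -(xi 𝔤 𝔲 X / m) * 𝔤 X μ.succ ν.succ
      + nabla 𝔤 (accel 𝔤 𝔲) X μ.succ ν.succ
      + lapseGrad β (Fin.tail X) μ * lapseGrad β (Fin.tail X) ν := by
  have hm' : (m : ℝ) ≠ 0 := Nat.cast_ne_zero.2 hm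
  have hβ := hw.lapse_ne_zero hX
  have hpd : pd μ.succ (fun Y => christoffel 𝔤 Y 0 0 ν.succ) X
      = pd μ.succ (fun Y => accel 𝔤 𝔲 Y ν.succ) X := by
    rw [pd_congr (hw.eventually_christoffel_zero_zero_succ hX ν),
      pd_congr (hw.eventually_accel_succ hX ν)]
  have hsum : ∑ p, (christoffel 𝔤 X p 0 ν.succ * christoffel 𝔤 X 0 μ.succ p
        - christoffel 𝔤 X p μ.succ ν.succ * christoffel 𝔤 X 0 0 p)
      = lapseGrad β (Fin.tail X) μ * lapseGrad β (Fin.tail X) ν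
        + hubble a (X 0) ^ 2 / β (Fin.tail X) ^ 2 * 𝔤 X μ.succ ν.succ
        - ∑ ρ : Fin m, christoffel 𝔤 X ρ.succ μ.succ ν.succ * lapseGrad β (Fin.tail X) ρ := by
    rw [Fin.sum_univ_succ, hw.christoffel_zero_zero_succ hX, hw.christoffel_zero_succ_zero hX,
      hw.christoffel_zero_zero_zero hX, Finset.sum_sub_distrib]
    simp only [hw.christoffel_succ_zero_succ hX, hw.christoffel_zero_zero_succ hX]
    simp only [ite_mul, zero_mul, Finset.sum_ite_eq', Finset.mem_univ, if_true,
      hw.christoffel_zero_succ_succ hX]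
    ring
  rw [riemann, hsum, hpd, hw.nabla_accel hX, hw.pd_zero_christoffel_zero_succ_succ hX,
    hw.xi_eq hX hm]
  field_simp
  ring

/-- The factor `β²` of `Γ^ν_{00}` cancels that of `Γ^0_{μν}`, and the metric in the latter lowers
the index of `u̇^ν`. -/
lemma sum_christoffel_mul_christoffel (μ : Fin m) :
    ∑ ν : Fin m, christoffel 𝔤 X ν.succ 0 0 * christoffel 𝔤 X 0 μ.succ ν.succ
      = hubble a (X 0) * lapseGrad β (Fin.tail X) μ := by
  have hβ := hw.lapse_ne_zero hX
  -- lowering the index of `u̇^ν` with the spatial block of the metric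
  have hlow : ∑ ν : Fin m, sharp 𝔤 (accel 𝔤 𝔲) X ν.succ * 𝔤 X μ.succ ν.succ
      = lapseGrad β (Fin.tail X) μ := by
    have h := congrFun (congrArg (fun A => Matrix.mulVec A (accel 𝔤 𝔲 X))
      (Matrix.mul_nonsing_inv _ (hw.isUnit_det hX))) μ.succ
    rw [← Matrix.mulVec_mulVec, Matrix.one_mulVec, hw.accel_succ hX] at h
    rw [← h, Matrix.mulVec, dotProduct, Fin.sum_univ_succ]
    simp only [warpedMetric_succ_zero, zero_mul, zero_add]
    exact Finset.sum_congr rfl fun ν _ => mul_comm _ _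
  simp only [hw.christoffel_time_time hX, hw.christoffel_zero_succ_succ hX]
  rw [← hlow, Finset.mul_sum]
  refine Finset.sum_congr rfl fun ν _ => ?_
  field_simp

lemma riemann_zero_succ_zero_zero (μ : Fin m) : riemann 𝔤 X 0 μ.succ 0 0 = 0 := by
  have hβ := hw.lapse_ne_zero hX
  have h0 : pd 0 (fun Y => christoffel 𝔤 Y 0 μ.succ 0) X = 0 := by
    rw [← pd_zero_comp_tail (X := X) fun x => lapseGrad β x μ]
    refine pd_congr ?_ 0
    filter_upwards [hw.mem_nhds hX] with Y hY using hw.christoffel_zero_succ_zero hY μ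
  have h1 : pd μ.succ (fun Y => christoffel 𝔤 Y 0 0 0) X = 0 := by
    rw [← pd_const (X := X) μ.succ 0]
    refine pd_congr ?_ _
    filter_upwards [hw.mem_nhds hX] with Y hY using hw.christoffel_zero_zero_zero hY
  rw [riemann, h0, h1, Fin.sum_univ_succ, hw.christoffel_zero_zero_zero hX,
    Finset.sum_sub_distrib, hw.sum_christoffel_mul_christoffel hX]
  simp only [hw.christoffel_zero_zero_succ hX, hw.christoffel_succ_succ_zero hX]
  simp

/-- The trace `Γ^p_{p0}` equals `m a'/a`. -/
lemma sum_christoffel_zero : ∑ p, christoffel 𝔤 X p p 0 = m * hubble a (X 0) := by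
  rw [Fin.sum_univ_succ, hw.christoffel_zero_zero_zero hX]
  simp [hw.christoffel_succ_succ_zero hX]

lemma pd_christoffel_diag_zero (k p : Fin (m + 1)) :
    pd k (fun Y => christoffel 𝔤 Y p p 0) X =
      Fin.cases 0 (fun _ => Fin.cases (deriv (hubble a) (X 0)) (fun _ => 0) k) p := by
  refine Fin.cases ?_ (fun μ => ?_) p
  · have : (fun Y => christoffel 𝔤 Y 0 0 0) =ᶠ[𝓝 X] fun _ => 0 := by
      filter_upwards [hw.mem_nhds hX] with Y hY using hw.christoffel_zero_zero_zero hY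
    rw [pd_congr this, pd_const]
    rfl
  · have : (fun Y => christoffel 𝔤 Y μ.succ μ.succ 0) =ᶠ[𝓝 X] fun Y => hubble a (Y 0) := by
      filter_upwards [hw.mem_nhds hX] with Y hY
      rw [hw.christoffel_succ_succ_zero hY, if_pos rfl]
    rw [pd_congr this]
    refine Fin.cases ?_ (fun ν => ?_) k
    · exact pd_zero_comp_time (hw.differentiableAt_hubble hX)
    · exact pd_succ_comp_time (hw.differentiableAt_hubble hX) ν

/-- `R_{jk} u^j u^k = ∇^p u̇_p - ξ`. -/
lemma ricci_zero_zero (hm : m ≠ 0) : ricci 𝔤 X 0 0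
    = β (Fin.tail X) ^ 2 * (divergence 𝔤 (accel 𝔤 𝔲) X - xi 𝔤 𝔲 X) := by
  have hβ := hw.lapse_ne_zero hX
  have hgi := differentiableAt_gInv (hw.differentiableAt_metric hX) (hw.isUnit_det hX)
  have hs : ∀ p, DifferentiableAt ℝ (fun Y => sharp 𝔤 (accel 𝔤 𝔲) Y p) X := fun p =>
    DifferentiableAt.fun_sum fun j _ => (hgi p j).mul (hw.differentiableAt_accel hX j)
  have hβ2 : DifferentiableAt ℝ (fun x => β x * β x) (Fin.tail X) :=
    (hw.differentiableAt_lapse hX).mul (hw.differentiableAt_lapse hX)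
  have hpd : ∀ p, pd p (fun Y => christoffel 𝔤 Y p 0 0) X
      = 2 * β (Fin.tail X) ^ 2 * (sharp 𝔤 (accel 𝔤 𝔲) X p * accel 𝔤 𝔲 X p)
        + β (Fin.tail X) ^ 2 * pd p (fun Y => sharp 𝔤 (accel 𝔤 𝔲) Y p) X := by
    intro p
    have hev : (fun Y => christoffel 𝔤 Y p 0 0) =ᶠ[𝓝 X]
        fun Y => (β (Fin.tail Y) * β (Fin.tail Y)) * sharp 𝔤 (accel 𝔤 𝔲) Y p := by
      filter_upwards [hw.mem_nhds hX] with Y hY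
      rw [hw.christoffel_time_time hY, sq]
    rw [pd_congr hev, pd_mul (differentiableAt_comp_tail hβ2) (hs p)]
    have : pd p (fun Y : Fin (m + 1) → ℝ => β (Fin.tail Y) * β (Fin.tail Y)) X
        = 2 * β (Fin.tail X) ^ 2 * accel 𝔤 𝔲 X p := by
      refine Fin.cases ?_ (fun μ => ?_) p
      · rw [pd_zero_comp_tail fun x => β x * β x, hw.accel_zero hX, mul_zero]
      · rw [pd_succ_comp_tail hβ2, pd_mul (hw.differentiableAt_lapse hX)
          (hw.differentiableAt_lapse hX), hw.accel_succ hX, lapseGrad]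
        field_simp
        ring
    rw [this]
    ring
  have hdiv := sum_pd_sharp (hw.eventually_isSymm hX) (hw.differentiableAt_metric hX)
    (hw.isUnit_det hX) (hw.differentiableAt_accel hX)
  -- `Γ^p_{00} = β² u̇^p` turns the first half of the Ricci tensor into a divergence; the derivative
  -- of `β²` contributes `2 β² η`
  have h1 : ∑ p, pd p (fun Y => christoffel 𝔤 Y p 0 0) X
        + ∑ p, ∑ l, christoffel 𝔤 X l 0 0 * christoffel 𝔤 X p p l
      = β (Fin.tail X) ^ 2 * (divergence 𝔤 (accel 𝔤 𝔲) X + 2 * eta 𝔤 𝔲 X) := by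
    simp only [hpd, Finset.sum_add_distrib, ← Finset.mul_sum, ← hdiv, eta]
    simp only [hw.christoffel_time_time hX, mul_add, Finset.mul_sum]
    have : ∀ p l, β (Fin.tail X) ^ 2 * sharp 𝔤 (accel 𝔤 𝔲) X l * christoffel 𝔤 X p p l
        = β (Fin.tail X) ^ 2 * (christoffel 𝔤 X p p l * sharp 𝔤 (accel 𝔤 𝔲) X l) := by
      intro p l
      ring
    simp only [this]
    have h2 : ∀ p, 2 * β (Fin.tail X) ^ 2 * (sharp 𝔤 (accel 𝔤 𝔲) X p * accel 𝔤 𝔲 X p)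
        = β (Fin.tail X) ^ 2 * (2 * (sharp 𝔤 (accel 𝔤 𝔲) X p * accel 𝔤 𝔲 X p)) := by
      intro p
      ring
    simp only [h2]
    ring
  have h2 : ∑ p, pd 0 (fun Y => christoffel 𝔤 Y p p 0) X = m * deriv (hubble a) (X 0) := by
    simp [hw.pd_christoffel_diag_zero hX, Fin.sum_univ_succ]
  have h3 : ∑ p, ∑ l, christoffel 𝔤 X l p 0 * christoffel 𝔤 X p 0 l
      = m * hubble a (X 0) ^ 2 + 2 * β (Fin.tail X) ^ 2 * eta 𝔤 𝔲 X := by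
    rw [Fin.sum_univ_succ, Fin.sum_univ_succ, hw.eta_eq_sum hX]
    simp only [Fin.sum_univ_succ (n := m), hw.christoffel_time_time hX, hw.sharp_accel_zero hX,
      hw.christoffel_succ_succ_zero hX, hw.christoffel_zero_succ_zero hX,
      hw.christoffel_succ_zero_succ hX, hw.christoffel_zero_zero_succ hX]
    simp only [mul_zero, zero_add, ite_mul, zero_mul, Finset.sum_ite_eq',
      Finset.mem_univ, if_true, Finset.sum_add_distrib, Finset.sum_const, Finset.card_univ,
      Fintype.card_fin, nsmul_eq_mul]
    rw [Finset.mul_sum]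
    have e1 : ∀ μ : Fin m, β (Fin.tail X) ^ 2 * sharp 𝔤 (accel 𝔤 𝔲) X μ.succ
        * lapseGrad β (Fin.tail X) μ
        = β (Fin.tail X) ^ 2 * (sharp 𝔤 (accel 𝔤 𝔲) X μ.succ * lapseGrad β (Fin.tail X) μ) :=
      fun μ => by ring
    have e2 : ∀ μ : Fin m, lapseGrad β (Fin.tail X) μ
        * (β (Fin.tail X) ^ 2 * sharp 𝔤 (accel 𝔤 𝔲) X μ.succ)
        = β (Fin.tail X) ^ 2 * (sharp 𝔤 (accel 𝔤 𝔲) X μ.succ * lapseGrad β (Fin.tail X) μ) :=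
      fun μ => by ring
    simp only [e1, e2, mul_assoc, ← Finset.mul_sum]
    ring
  simp only [ricci, riemann, Finset.sum_add_distrib, Finset.sum_sub_distrib,
    Finset.sum_neg_distrib]
  rw [hw.xi_eq hX hm, h2, h3]
  have h1' := h1
  field_simp
  linarith

lemma ricci_succ_zero (μ : Fin m) : ricci 𝔤 X μ.succ 0
    = ((m : ℝ) - 1) * hubble a (X 0) * lapseGrad β (Fin.tail X) μ := by
  have h1 : ∑ p, pd μ.succ (fun Y => christoffel 𝔤 Y p p 0) X = 0 := by
    simp [hw.pd_christoffel_diag_zero hX, Fin.sum_univ_succ]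
  have h2 : ∑ p, pd p (fun Y => christoffel 𝔤 Y p μ.succ 0) X = 0 := by
    refine Finset.sum_eq_zero fun p _ => ?_
    refine Fin.cases ?_ (fun ρ => ?_) p
    · rw [← pd_zero_comp_tail (X := X) fun x => lapseGrad β x μ]
      refine pd_congr ?_ 0
      filter_upwards [hw.mem_nhds hX] with Y hY using hw.christoffel_zero_succ_zero hY μ
    · by_cases hρ : ρ = μ
      · subst hρ
        rw [hw.pd_christoffel_diag_zero hX]
        rfl
      · rw [← pd_const (X := X) ρ.succ 0]
        refine pd_congr ?_ _
        filter_upwards [hw.mem_nhds hX] with Y hY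
        rw [hw.christoffel_succ_succ_zero hY, if_neg hρ]
  have h3 : ∑ p, ∑ l, christoffel 𝔤 X l μ.succ 0 * christoffel 𝔤 X p p l
      = lapseGrad β (Fin.tail X) μ * (m * hubble a (X 0))
        + hubble a (X 0) * (lapseGrad β (Fin.tail X) μ
          + ∑ ρ : Fin m, christoffel 𝔤 X ρ.succ ρ.succ μ.succ) := by
    rw [Finset.sum_comm, Fin.sum_univ_succ]
    simp only [← Finset.mul_sum]
    simp only [hw.sum_christoffel_zero hX, hw.christoffel_zero_succ_zero hX,
      hw.christoffel_succ_succ_zero hX, ite_mul, zero_mul, Finset.sum_ite_eq', Finset.mem_univ,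
      if_true]
    rw [Fin.sum_univ_succ, hw.christoffel_zero_zero_succ hX]
  have h4 : ∑ p, ∑ l, christoffel 𝔤 X l p 0 * christoffel 𝔤 X p μ.succ l
      = 2 * hubble a (X 0) * lapseGrad β (Fin.tail X) μ
        + hubble a (X 0) * ∑ ρ : Fin m, christoffel 𝔤 X ρ.succ ρ.succ μ.succ := by
    rw [Fin.sum_univ_succ, Fin.sum_univ_succ, hw.christoffel_zero_zero_zero hX,
      hw.sum_christoffel_mul_christoffel hX]
    simp only [Fin.sum_univ_succ (n := m), hw.christoffel_zero_succ_zero hX,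
      hw.christoffel_succ_succ_zero hX, ite_mul, zero_mul, Finset.sum_ite_eq', Finset.mem_univ,
      if_true, Finset.sum_add_distrib, ← Finset.mul_sum, hw.christoffel_swap hX _ μ.succ]
    simp only [hw.christoffel_succ_zero_succ hX, mul_ite, mul_zero, Finset.sum_ite_eq',
      Finset.mem_univ, if_true]
    ring
  simp only [ricci, riemann, Finset.sum_add_distrib, Finset.sum_sub_distrib,
    Finset.sum_neg_distrib]
  rw [h1, h2, h3, h4]
  ring

lemma ricci_zero_succ (μ : Fin m) : ricci 𝔤 X 0 μ.succ
    = ((m : ℝ) - 1) * hubble a (X 0) * lapseGrad β (Fin.tail X) μ := by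
  have h1 : ∀ p, pd 0 (fun Y => christoffel 𝔤 Y p p μ.succ) X = 0 := by
    intro p
    refine Fin.cases ?_ (fun ρ => ?_) p
    · rw [pd_congr (hw.eventually_christoffel_zero_zero_succ hX μ)]
      exact pd_zero_comp_tail fun x => lapseGrad β x μ
    -- `γ` need not be twice differentiable, but the time derivative vanishes in any case
    · rw [← pd_zero_comp_tail (X := X) fun x => christoffel γ x ρ ρ μ]
      refine pd_congr ?_ 0
      filter_upwards [hw.mem_nhds hX] with Y hY using hw.christoffel_succ_succ_succ hY ρ ρ μ
  have h2 : ∑ p, pd μ.succ (fun Y => christoffel 𝔤 Y p p 0) X = 0 := by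
    simp [hw.pd_christoffel_diag_zero hX, Fin.sum_univ_succ]
  have h3 : ∀ p, pd p (fun Y => christoffel 𝔤 Y p 0 μ.succ) X
      = pd p (fun Y => christoffel 𝔤 Y p μ.succ 0) X := by
    intro p
    refine pd_congr ?_ p
    filter_upwards [hw.mem_nhds hX] with Y hY using hw.christoffel_swap hY p 0 μ.succ
  have h4 : ∑ p, ∑ l, christoffel 𝔤 X l p μ.succ * christoffel 𝔤 X p 0 l
      = ∑ p, ∑ l, christoffel 𝔤 X l p 0 * christoffel 𝔤 X p μ.succ l := by
    rw [Finset.sum_comm]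
    refine Finset.sum_congr rfl fun p _ => Finset.sum_congr rfl fun l _ => ?_
    rw [hw.christoffel_swap hX p l μ.succ, hw.christoffel_swap hX l 0 p, mul_comm]
  rw [← hw.ricci_succ_zero hX μ]
  simp only [ricci, riemann, Finset.sum_add_distrib, Finset.sum_sub_distrib,
    Finset.sum_neg_distrib, h1, h2, h3, h4, hw.christoffel_swap hX _ 0 μ.succ,
    Finset.sum_const_zero]

end IsWarping

/-! ### The electric tensor and the projected gradient of the acceleration -/

lemma wVec_eq {n : ℕ} (g : (Fin n → ℝ) → Matrix (Fin n) (Fin n) ℝ)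
    (u : (Fin n → ℝ) → Fin n → ℝ) (X : Fin n → ℝ) (k : Fin n) : wVec g u X k = 1 / (2 * eta g u X)
    * ∑ p, (∑ r, projN g u X k r * gInv g X r p) * pd p (eta g u) X := by
  simp only [wVec, Finset.mul_sum, Finset.sum_mul]
  rw [Finset.sum_comm]
  exact Finset.sum_congr rfl fun _ _ => Finset.sum_congr rfl fun _ _ => by ring

/-- The transverse projection `N_{jr} N_{ks} ∇^r u̇^s`, with the metric absorbed in the
projectors. -/
lemma sum_projN_projN_gradAccelUp {n : ℕ} (g : (Fin n → ℝ) → Matrix (Fin n) (Fin n) ℝ)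
    (u : (Fin n → ℝ) → Fin n → ℝ) (X : Fin n → ℝ) (j k : Fin n) :
    ∑ r, ∑ s, projN g u X j r * projN g u X k s * gradAccelUp g u X r s
      = ∑ p, (∑ r, projN g u X j r * gInv g X r p)
          * ∑ q, (∑ s, projN g u X k s * gInv g X s q) * nabla g (accel g u) X p q := by
  simp only [gradAccelUp]
  set T := nabla g (accel g u) X
  set N := projN g u X
  set G := gInv g X
  calc ∑ r, ∑ s, N j r * N k s * ∑ p, ∑ q, G r p * G s q * T p q
      = ∑ r, ∑ p, N j r * G r p * ∑ s, ∑ q, N k s * G s q * T p q := by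
        refine Finset.sum_congr rfl fun r _ => ?_
        simp only [Finset.mul_sum]
        rw [Finset.sum_comm]
        refine Finset.sum_congr rfl fun p _ => Finset.sum_congr rfl fun s _ =>
          Finset.sum_congr rfl fun q _ => ?_
        ring
    _ = _ := by
        rw [Finset.sum_comm]
        simp only [← Finset.sum_mul]
        refine Finset.sum_congr rfl fun p _ => ?_
        congr 1
        rw [Finset.sum_comm]
        simp only [← Finset.sum_mul]

namespace IsWarping

variable {m : ℕ} {I : Set ℝ} {V : Set (Fin m → ℝ)} {a : ℝ → ℝ} {β : (Fin m → ℝ) → ℝ}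
  {γ : (Fin m → ℝ) → Matrix (Fin m) (Fin m) ℝ} (hw : IsWarping I V a β γ)
  {X : Fin (m + 1) → ℝ} (hX : X ∈ warpedDomain I V)

include hw hX

local notation "𝔤" => warpedMetric a β γ
local notation "𝔲" => comoving β

lemma electric_eq (k l : Fin (m + 1)) : electric 𝔤 𝔲 X k l
    = 1 / β (Fin.tail X) ^ 2 * (-β (Fin.tail X) ^ 2 * riemann 𝔤 X 0 k l 0
      + (-β (Fin.tail X) ^ 2 * ricci 𝔤 X k l - 𝔤 X k 0 * ricci 𝔤 X 0 l
          + ricci 𝔤 X 0 0 * 𝔤 X k l - ricci 𝔤 X k 0 * 𝔤 X 0 l) / ((m : ℝ) - 1)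
      - scalarCurvature 𝔤 X * (-β (Fin.tail X) ^ 2 * 𝔤 X k l - 𝔤 X k 0 * 𝔤 X 0 l)
          / ((m : ℝ) * ((m : ℝ) - 1))) := by
  have hβ := hw.lapse_ne_zero hX
  rw [electric, Fin.sum_univ_succ, Fin.sum_univ_succ]
  simp only [hw.sharp_comoving_zero hX, hw.sharp_comoving_succ hX, mul_zero, zero_mul,
    Finset.sum_const_zero, add_zero]
  have hn : ((m + 1 : ℕ) : ℝ) - 2 = (m : ℝ) - 1 := by
    push_cast
    ring
  have hn' : ((m + 1 : ℕ) : ℝ) - 1 = (m : ℝ) := by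
    push_cast
    ring
  rw [weyl, hn, hn', riemannLow, Fin.sum_univ_succ]
  simp only [warpedMetric_succ_zero, warpedMetric_zero_zero, mul_zero, Finset.sum_const_zero]
  ring

lemma electric_zero_zero : electric 𝔤 𝔲 X 0 0 = 0 := by
  rw [hw.electric_eq hX, riemann_self_self]
  simp only [warpedMetric_zero_zero]
  ring

lemma electric_zero_succ (μ : Fin m) : electric 𝔤 𝔲 X 0 μ.succ = 0 := by
  rw [hw.electric_eq hX, riemann_self_self]
  simp only [warpedMetric_zero_zero, warpedMetric_zero_succ]
  ring

lemma electric_succ_zero (μ : Fin m) : electric 𝔤 𝔲 X μ.succ 0 = 0 := by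
  rw [hw.electric_eq hX, hw.riemann_zero_succ_zero_zero hX]
  simp only [warpedMetric_zero_zero, warpedMetric_succ_zero]
  ring

/-- The spatial Ricci tensor, obtained by solving the definition of the electric tensor for it: the
full Riemann tensor enters only through the tidal tensor, which is known. -/
lemma ricci_succ_succ (hm : 2 ≤ m) (μ ν : Fin m) : ricci 𝔤 X μ.succ ν.succ
    = 𝔤 X μ.succ ν.succ * ((scalarCurvature 𝔤 X - xi 𝔤 𝔲 X) / m + divergence 𝔤 (accel 𝔤 𝔲) X)
      - ((m : ℝ) - 1) * (nabla 𝔤 (accel 𝔤 𝔲) X μ.succ ν.succ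
        + lapseGrad β (Fin.tail X) μ * lapseGrad β (Fin.tail X) ν
        + electric 𝔤 𝔲 X μ.succ ν.succ) := by
  have hβ := hw.lapse_ne_zero hX
  have hm2 : (2 : ℝ) ≤ m := by exact_mod_cast hm
  have hm0 : (m : ℝ) ≠ 0 := by positivity
  have hm1 : (m : ℝ) - 1 ≠ 0 := by linarith
  rw [hw.electric_eq hX, hw.riemann_zero_succ_succ_zero hX (by lia),
    hw.ricci_zero_zero hX (by lia), warpedMetric_zero_succ, warpedMetric_succ_zero]
  field_simp
  ring

/-- `½ u̇^s ∇_s η = u̇^p u̇^q ∇_p u̇_q`. -/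
lemma sum_sum_nabla_accel :
    ∑ p, sharp 𝔤 (accel 𝔤 𝔲) X p
        * ∑ q, sharp 𝔤 (accel 𝔤 𝔲) X q * nabla 𝔤 (accel 𝔤 𝔲) X p q
      = scalarAlong 𝔤 (accel 𝔤 𝔲) (eta 𝔤 𝔲) X / 2 := by
  simp only [scalarAlong, hw.pd_eta hX]
  rw [Finset.sum_div]
  exact Finset.sum_congr rfl fun p _ => by ring

/-- Raising one index of the projector: `N_j^p = δ_j^p + u_j u^p - u̇_j u̇^p / η`. -/
lemma sum_projN_mul_gInv (j p : Fin (m + 1)) : ∑ r, projN 𝔤 𝔲 X j r * gInv 𝔤 X r p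
    = (if j = p then 1 else 0) + 𝔲 X j * sharp 𝔤 𝔲 X p
      - accel 𝔤 𝔲 X j * sharp 𝔤 (accel 𝔤 𝔲) X p / eta 𝔤 𝔲 X := by
  have h1 : ∑ r, 𝔤 X j r * gInv 𝔤 X r p = if j = p then 1 else 0 := by
    rw [← Matrix.one_apply, ← Matrix.mul_nonsing_inv _ (hw.isUnit_det hX), Matrix.mul_apply]
    rfl
  simp only [projN, sub_mul, add_mul, Finset.sum_add_distrib, Finset.sum_sub_distrib, h1]
  simp only [sharp, Finset.mul_sum, Finset.sum_div, hw.gInv_symm hX _ p]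
  congr 1
  · congr 1
    exact Finset.sum_congr rfl fun r _ => by ring
  · exact Finset.sum_congr rfl fun r _ => by ring

lemma sum_projN_zero_mul_gInv (p : Fin (m + 1)) :
    ∑ r, projN 𝔤 𝔲 X 0 r * gInv 𝔤 X r p = 0 := by
  have hβ := hw.lapse_ne_zero hX
  rw [hw.sum_projN_mul_gInv hX, hw.accel_zero hX]
  refine Fin.cases ?_ (fun μ => ?_) p
  · rw [hw.sharp_comoving_zero hX, comoving_zero]
    field_simp
    simp
  · rw [hw.sharp_comoving_succ hX]
    simp [(Fin.succ_ne_zero μ).symm]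

lemma sum_projN_succ_mul_gInv (μ : Fin m) (p : Fin (m + 1)) :
    ∑ r, projN 𝔤 𝔲 X μ.succ r * gInv 𝔤 X r p
      = (if μ.succ = p then 1 else 0)
        - lapseGrad β (Fin.tail X) μ * sharp 𝔤 (accel 𝔤 𝔲) X p / eta 𝔤 𝔲 X := by
  rw [hw.sum_projN_mul_gInv hX, hw.accel_succ hX]
  simp

lemma projN_zero (k : Fin (m + 1)) : projN 𝔤 𝔲 X 0 k = 0 := by
  rw [projN, hw.accel_zero hX]
  refine Fin.cases ?_ (fun μ => ?_) k
  · simp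
    ring
  · simp

lemma projN_symm (j k : Fin (m + 1)) : projN 𝔤 𝔲 X j k = projN 𝔤 𝔲 X k j := by
  rw [projN, projN, (hw.isSymm_metric hX).apply k j]
  ring

lemma wVec_zero : wVec 𝔤 𝔲 X 0 = 0 := by
  rw [wVec_eq]
  simp [hw.sum_projN_zero_mul_gInv hX]

lemma wVec_succ (μ : Fin m) : wVec 𝔤 𝔲 X μ.succ = 1 / (2 * eta 𝔤 𝔲 X)
    * (pd μ.succ (eta 𝔤 𝔲) X
      - lapseGrad β (Fin.tail X) μ * scalarAlong 𝔤 (accel 𝔤 𝔲) (eta 𝔤 𝔲) X / eta 𝔤 𝔲 X) := by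
  rw [wVec_eq]
  simp only [hw.sum_projN_succ_mul_gInv hX, sub_mul, Finset.sum_sub_distrib, ite_mul, one_mul,
    zero_mul, Finset.sum_ite_eq, Finset.mem_univ, if_true, scalarAlong, Finset.mul_sum,
    Finset.sum_div]
  congr 2
  exact Finset.sum_congr rfl fun _ _ => by ring

lemma sum_projN_projN_gradAccelUp_zero (k : Fin (m + 1)) :
    ∑ r, ∑ s, projN 𝔤 𝔲 X 0 r * projN 𝔤 𝔲 X k s * gradAccelUp 𝔤 𝔲 X r s = 0 := by
  rw [sum_projN_projN_gradAccelUp]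
  simp [hw.sum_projN_zero_mul_gInv hX]

lemma sum_projN_projN_gradAccelUp_zero' (j : Fin (m + 1)) :
    ∑ r, ∑ s, projN 𝔤 𝔲 X j r * projN 𝔤 𝔲 X 0 s * gradAccelUp 𝔤 𝔲 X r s = 0 := by
  rw [sum_projN_projN_gradAccelUp]
  simp [hw.sum_projN_zero_mul_gInv hX]

lemma sum_projN_projN_gradAccelUp_succ (μ ν : Fin m) :
    ∑ r, ∑ s, projN 𝔤 𝔲 X μ.succ r * projN 𝔤 𝔲 X ν.succ s * gradAccelUp 𝔤 𝔲 X r s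
      = nabla 𝔤 (accel 𝔤 𝔲) X μ.succ ν.succ
        - (lapseGrad β (Fin.tail X) μ * pd ν.succ (eta 𝔤 𝔲) X
          + lapseGrad β (Fin.tail X) ν * pd μ.succ (eta 𝔤 𝔲) X) / (2 * eta 𝔤 𝔲 X)
        + lapseGrad β (Fin.tail X) μ * lapseGrad β (Fin.tail X) ν
          * scalarAlong 𝔤 (accel 𝔤 𝔲) (eta 𝔤 𝔲) X / (2 * eta 𝔤 𝔲 X ^ 2) := by
  have hin : ∀ p, ∑ q, (∑ s, projN 𝔤 𝔲 X ν.succ s * gInv 𝔤 X s q) * nabla 𝔤 (accel 𝔤 𝔲) X p q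
      = nabla 𝔤 (accel 𝔤 𝔲) X p ν.succ - lapseGrad β (Fin.tail X) ν / eta 𝔤 𝔲 X
        * ∑ q, sharp 𝔤 (accel 𝔤 𝔲) X q * nabla 𝔤 (accel 𝔤 𝔲) X p q := by
    intro p
    simp only [hw.sum_projN_succ_mul_gInv hX, sub_mul, Finset.sum_sub_distrib, ite_mul, one_mul,
      zero_mul, Finset.sum_ite_eq, Finset.mem_univ, if_true, Finset.mul_sum]
    congr 1
    exact Finset.sum_congr rfl fun _ _ => by ring
  have hout : ∀ f : Fin (m + 1) → ℝ, ∑ p, (∑ s, projN 𝔤 𝔲 X μ.succ s * gInv 𝔤 X s p) * f p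
      = f μ.succ - lapseGrad β (Fin.tail X) μ / eta 𝔤 𝔲 X
        * ∑ p, sharp 𝔤 (accel 𝔤 𝔲) X p * f p := by
    intro f
    simp only [hw.sum_projN_succ_mul_gInv hX, sub_mul, Finset.sum_sub_distrib, ite_mul, one_mul,
      zero_mul, Finset.sum_ite_eq, Finset.mem_univ, if_true, Finset.mul_sum]
    congr 1
    exact Finset.sum_congr rfl fun _ _ => by ring
  have hcontr : ∑ p, sharp 𝔤 (accel 𝔤 𝔲) X p * nabla 𝔤 (accel 𝔤 𝔲) X p ν.succ
      = pd ν.succ (eta 𝔤 𝔲) X / 2 := by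
    rw [hw.pd_eta hX]
    simp only [hw.nabla_accel_symm hX _ ν.succ]
    ring
  have hcontr' : ∑ p, sharp 𝔤 (accel 𝔤 𝔲) X p * nabla 𝔤 (accel 𝔤 𝔲) X μ.succ p
      = pd μ.succ (eta 𝔤 𝔲) X / 2 := by
    rw [hw.pd_eta hX]
    ring
  have hsplit : ∑ p, sharp 𝔤 (accel 𝔤 𝔲) X p * (nabla 𝔤 (accel 𝔤 𝔲) X p ν.succ
        - lapseGrad β (Fin.tail X) ν / eta 𝔤 𝔲 X
          * ∑ q, sharp 𝔤 (accel 𝔤 𝔲) X q * nabla 𝔤 (accel 𝔤 𝔲) X p q)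
      = pd ν.succ (eta 𝔤 𝔲) X / 2 - lapseGrad β (Fin.tail X) ν / eta 𝔤 𝔲 X
          * (scalarAlong 𝔤 (accel 𝔤 𝔲) (eta 𝔤 𝔲) X / 2) := by
    rw [← hcontr, ← hw.sum_sum_nabla_accel hX, Finset.mul_sum, ← Finset.sum_sub_distrib]
    exact Finset.sum_congr rfl fun p _ => by ring
  rw [sum_projN_projN_gradAccelUp]
  simp only [hin]
  rw [hout, hsplit, hcontr']
  ring

/-- The transverse trace `N_{rs} ∇^r u̇^s = ∇^p u̇_p - η - u̇^s ∇_s η / (2 η)`. -/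
lemma sum_projN_gradAccelUp :
    ∑ r, ∑ s, projN 𝔤 𝔲 X r s * gradAccelUp 𝔤 𝔲 X r s
      = divergence 𝔤 (accel 𝔤 𝔲) X - eta 𝔤 𝔲 X
        - scalarAlong 𝔤 (accel 𝔤 𝔲) (eta 𝔤 𝔲) X / (2 * eta 𝔤 𝔲 X) := by
  have hβ := hw.lapse_ne_zero hX
  set T := nabla 𝔤 (accel 𝔤 𝔲) X with hT
  have h1 : ∑ r, ∑ s, projN 𝔤 𝔲 X r s * gradAccelUp 𝔤 𝔲 X r s
      = ∑ p, ∑ q, (∑ s, (∑ r, projN 𝔤 𝔲 X s r * gInv 𝔤 X r p) * gInv 𝔤 X s q) * T p q := by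
    simp only [gradAccelUp, Finset.mul_sum, Finset.sum_mul]
    rw [Finset.sum_comm]
    calc ∑ s, ∑ r, ∑ p, ∑ q, projN 𝔤 𝔲 X r s * (gInv 𝔤 X r p * gInv 𝔤 X s q * T p q)
        = ∑ s, ∑ p, ∑ q, ∑ r, projN 𝔤 𝔲 X s r * gInv 𝔤 X r p * gInv 𝔤 X s q * T p q := by
          refine Finset.sum_congr rfl fun s _ => ?_
          rw [Finset.sum_comm]
          refine Finset.sum_congr rfl fun p _ => ?_
          rw [Finset.sum_comm]
          refine Finset.sum_congr rfl fun q _ => Finset.sum_congr rfl fun r _ => ?_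
          rw [hw.projN_symm hX r s]
          ring
      _ = _ := by
          rw [Finset.sum_comm]
          refine Finset.sum_congr rfl fun p _ => ?_
          rw [Finset.sum_comm]
  have h2 : ∀ p q, ∑ s, (∑ r, projN 𝔤 𝔲 X s r * gInv 𝔤 X r p) * gInv 𝔤 X s q
      = gInv 𝔤 X p q + sharp 𝔤 𝔲 X p * sharp 𝔤 𝔲 X q
        - sharp 𝔤 (accel 𝔤 𝔲) X p * sharp 𝔤 (accel 𝔤 𝔲) X q / eta 𝔤 𝔲 X := by
    intro p q
    simp only [hw.sum_projN_mul_gInv hX, sub_mul, add_mul, Finset.sum_add_distrib,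
      Finset.sum_sub_distrib, ite_mul, one_mul, zero_mul, Finset.sum_ite_eq', Finset.mem_univ,
      if_true]
    rw [sharp.eq_def 𝔤 𝔲 X q, sharp.eq_def 𝔤 (accel 𝔤 𝔲) X q, Finset.mul_sum, Finset.mul_sum,
      Finset.sum_div]
    congr 1
    · congr 1
      exact Finset.sum_congr rfl fun s _ => by rw [hw.gInv_symm hX q s]; ring
    · exact Finset.sum_congr rfl fun s _ => by rw [hw.gInv_symm hX q s]; ring
  have h3 : ∑ p, ∑ q, sharp 𝔤 𝔲 X p * sharp 𝔤 𝔲 X q * T p q = -eta 𝔤 𝔲 X := by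
    rw [Fin.sum_univ_succ, Fin.sum_univ_succ]
    simp only [hw.sharp_comoving_zero hX, hw.sharp_comoving_succ hX, zero_mul, mul_zero,
      Finset.sum_const_zero, add_zero]
    rw [hT, hw.nabla_accel_zero_zero hX]
    field_simp
  have h4 : ∑ p, ∑ q, sharp 𝔤 (accel 𝔤 𝔲) X p * sharp 𝔤 (accel 𝔤 𝔲) X q / eta 𝔤 𝔲 X * T p q
      = scalarAlong 𝔤 (accel 𝔤 𝔲) (eta 𝔤 𝔲) X / (2 * eta 𝔤 𝔲 X) := by
    rw [← div_div, ← hw.sum_sum_nabla_accel hX, Finset.sum_div]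
    refine Finset.sum_congr rfl fun p _ => ?_
    rw [Finset.mul_sum, Finset.sum_div]
    exact Finset.sum_congr rfl fun q _ => by ring
  rw [h1]
  simp only [h2, sub_mul, add_mul, Finset.sum_add_distrib, Finset.sum_sub_distrib]
  rw [h3, h4]
  simp only [divergence, ← hT]
  ring

lemma piTensor_eq (j k : Fin (m + 1)) : piTensor 𝔤 𝔲 X j k
    = ∑ r, ∑ s, projN 𝔤 𝔲 X j r * projN 𝔤 𝔲 X k s * gradAccelUp 𝔤 𝔲 X r s
      - projN 𝔤 𝔲 X j k / ((m : ℝ) - 1) * (divergence 𝔤 (accel 𝔤 𝔲) X - eta 𝔤 𝔲 X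
        - scalarAlong 𝔤 (accel 𝔤 𝔲) (eta 𝔤 𝔲) X / (2 * eta 𝔤 𝔲 X)) := by
  have hn : ((m + 1 : ℕ) : ℝ) - 2 = (m : ℝ) - 1 := by
    push_cast
    ring
  rw [← hw.sum_projN_gradAccelUp hX, piTensor, hn, Finset.mul_sum, ← Finset.sum_sub_distrib]
  refine Finset.sum_congr rfl fun r _ => ?_
  rw [Finset.mul_sum, ← Finset.sum_sub_distrib]
  exact Finset.sum_congr rfl fun s _ => by ring

lemma piTensor_zero_left (k : Fin (m + 1)) : piTensor 𝔤 𝔲 X 0 k = 0 := by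
  rw [hw.piTensor_eq hX, hw.sum_projN_projN_gradAccelUp_zero hX, hw.projN_zero hX]
  simp

lemma piTensor_zero_right (j : Fin (m + 1)) : piTensor 𝔤 𝔲 X j 0 = 0 := by
  rw [hw.piTensor_eq hX, hw.sum_projN_projN_gradAccelUp_zero' hX, hw.projN_symm hX,
    hw.projN_zero hX]
  simp

/-- The Ricci tensor of a doubly warped metric on a coordinate domain. -/
theorem ricci_eq (hm : 2 ≤ m) (hη : eta 𝔤 𝔲 X ≠ 0) (j k : Fin (m + 1)) :
    let n : ℝ := (m : ℝ) + 1
    let g := 𝔤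
    let u := 𝔲
    let u' := accel g u
    let R := scalarCurvature g X
    let φ := expansion g u X
    let ξ := xi g u X
    let η := eta g u X
    let D := divergence g u' X
    let K := scalarAlong g u' (eta g u) X
    let w := wVec g u X
    ricci g X j k =
      u X j * u X k * ((R - n * ξ) / (n - 1) + D + η + K / (2 * η))
      + g X j k * ((R - ξ) / (n - 1) + η + K / (2 * η))
      - (n - 2) * φ * (u X j * u' X k + u' X j * u X k)
      - u' X j * u' X k / η * ((n - 1) * (η + K / (2 * η)) - D)
      - (n - 2) * (u' X j * w k + w j * u' X k + piTensor g u X j k + electric g u X j k) := by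
  intro n g u u' R φ ξ η D K w
  have hβ := hw.lapse_ne_zero hX
  have hm2 : (2 : ℝ) ≤ m := by exact_mod_cast hm
  have hm0 : (m : ℝ) ≠ 0 := by positivity
  have hm1 : (m : ℝ) - 1 ≠ 0 := by linarith
  have hn1 : n - 1 = m := add_sub_cancel_right _ _
  have hn2 : n - 2 = (m : ℝ) - 1 := by
    simp only [n]
    ring
  have hn : n = (m : ℝ) + 1 := rfl
  rw [hn1, hn2]
  refine Fin.cases ?_ (fun μ => ?_) j <;> refine Fin.cases ?_ (fun ν => ?_) k
  · simp only [g, u, u', w, D, ξ, hw.ricci_zero_zero hX (by lia), hw.accel_zero hX,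
      hw.wVec_zero hX, hw.piTensor_zero_left hX, hw.electric_zero_zero hX, comoving_zero,
      warpedMetric_zero_zero]
    rw [hn]
    field_simp
    ring
  · simp only [g, u, u', w, φ, hw.ricci_zero_succ hX, hw.accel_zero hX, hw.accel_succ hX,
      hw.wVec_zero hX, hw.piTensor_zero_left hX, hw.electric_zero_succ hX, comoving_zero,
      comoving_succ, warpedMetric_zero_succ, hw.expansion_eq hX (by lia : m ≠ 0)]
    field_simp
    ring
  · simp only [g, u, u', w, φ, hw.ricci_succ_zero hX, hw.accel_zero hX, hw.accel_succ hX,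
      hw.wVec_zero hX, hw.piTensor_zero_right hX, hw.electric_succ_zero hX, comoving_zero,
      comoving_succ, warpedMetric_succ_zero, hw.expansion_eq hX (by lia : m ≠ 0)]
    field_simp
    ring
  · have hN : projN 𝔤 𝔲 X μ.succ ν.succ = 𝔤 X μ.succ ν.succ
        - lapseGrad β (Fin.tail X) μ * lapseGrad β (Fin.tail X) ν / eta 𝔤 𝔲 X := by
      rw [projN, hw.accel_succ hX, hw.accel_succ hX]
      simp
    simp only [g, u, u', w, hw.ricci_succ_succ hX hm, hw.accel_succ hX, hw.wVec_succ hX,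
      hw.piTensor_eq hX, hw.sum_projN_projN_gradAccelUp_succ hX, comoving_succ, hN, R, ξ, η, D, K]
    generalize eta 𝔤 𝔲 X = η at *
    generalize 𝔤 X μ.succ ν.succ = G
    field_simp
    ring

end IsWarping

/-! ### Regularity of the metric components in a chart -/

section Chart
variable {m : ℕ} {M : Type*} [TopologicalSpace M] [ChartedSpace (EuclideanSpace ℝ (Fin m)) M]

lemma chartMetric_symm [IsManifold (𝓡 m) ∞ M]
    (gs : Bundle.ContMDiffRiemannianMetric (𝓡 m) ∞ (EuclideanSpace ℝ (Fin m))
      (TangentSpace (𝓡 m) : M → Type _))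
    (e : OpenPartialHomeomorph M (EuclideanSpace ℝ (Fin m)))
    (x : EuclideanSpace ℝ (Fin m)) (μ ν : Fin m) :
    chartMetric gs e x μ ν = chartMetric gs e x ν μ := gs.symm _ _ _

lemma contDiffOn_comp_chart_symm {b : M → ℝ} (hb : ContMDiff (𝓡 m) 𝓘(ℝ, ℝ) ∞ b)
    {e : OpenPartialHomeomorph M (EuclideanSpace ℝ (Fin m))}
    (he : e ∈ IsManifold.maximalAtlas (𝓡 m) ∞ M) :
    ContDiffOn ℝ ∞ (fun x => b (e.symm x)) e.target := by
  rw [← contMDiffOn_iff_contDiffOn]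
  exact hb.comp_contMDiffOn (contMDiffOn_symm_of_mem_maximalAtlas he)

/-- The coordinate vector fields of a chart are linearly independent, because `e ∘ e.symm` is the
identity near `x` and both factors are differentiable. -/
lemma injective_mfderiv_chart_symm {e : OpenPartialHomeomorph M (EuclideanSpace ℝ (Fin m))}
    (he : e ∈ IsManifold.maximalAtlas (𝓡 m) ∞ M) {x : EuclideanSpace ℝ (Fin m)}
    (hx : x ∈ e.target) : Function.Injective (mfderiv (𝓡 m) (𝓡 m) e.symm x) := by
  have h1 : MDifferentiableAt (𝓡 m) (𝓡 m) e.symm x :=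
    (contMDiffAt_symm_of_mem_maximalAtlas he hx).mdifferentiableAt (by simp)
  have h2 : MDifferentiableAt (𝓡 m) (𝓡 m) e (e.symm x) :=
    (contMDiffAt_of_mem_maximalAtlas he (e.map_target hx)).mdifferentiableAt (by simp)
  have h3 : mfderiv (𝓡 m) (𝓡 m) (e ∘ e.symm) x
      = mfderiv (𝓡 m) (𝓡 m) (id : EuclideanSpace ℝ (Fin m) → _) x := by
    refine Filter.EventuallyEq.mfderiv_eq ?_
    filter_upwards [e.open_target.mem_nhds hx] with y hy
    exact e.right_inv hy
  rw [mfderiv_comp x h2 h1, mfderiv_id] at h3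
  intro v w hvw
  have := congrArg (mfderiv (𝓡 m) (𝓡 m) e (e.symm x)) hvw
  have hv := DFunLike.congr_fun h3 v
  have hw := DFunLike.congr_fun h3 w
  exact hv.symm.trans (this.trans hw)

/-- A vector in the kernel of the Gram matrix would be a null vector of the metric, hence zero by
positivity. -/
lemma isUnit_det_chartMetric [IsManifold (𝓡 m) ∞ M]
    (gs : Bundle.ContMDiffRiemannianMetric (𝓡 m) ∞ (EuclideanSpace ℝ (Fin m))
      (TangentSpace (𝓡 m) : M → Type _))
    {e : OpenPartialHomeomorph M (EuclideanSpace ℝ (Fin m))}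
    (he : e ∈ IsManifold.maximalAtlas (𝓡 m) ∞ M) {x : EuclideanSpace ℝ (Fin m)}
    (hx : x ∈ e.target) : IsUnit (Matrix.of (chartMetric gs e x)).det := by
  rw [isUnit_iff_ne_zero, ne_eq, ← Matrix.exists_mulVec_eq_zero_iff]
  rintro ⟨v, hv, hv0⟩
  set w : EuclideanSpace ℝ (Fin m) := WithLp.toLp 2 v with hw
  have hwsum : w = ∑ μ, v μ • EuclideanSpace.single μ (1 : ℝ) := by
    ext i
    simp [hw, Finset.sum_apply, Pi.single_apply]
  set A : EuclideanSpace ℝ (Fin m) →L[ℝ] TangentSpace (𝓡 m) (e.symm x) :=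
    mfderiv (𝓡 m) (𝓡 m) e.symm x with hA
  have hq : gs.inner (e.symm x) (A w) (A w) = 0 := by
    have : gs.inner (e.symm x) (A w) (A w)
        = ∑ μ, v μ * ((Matrix.of (chartMetric gs e x)).mulVec v) μ := by
      simp only [hwsum, map_sum, map_smul, sum_apply,
        smul_apply, smul_eq_mul, Matrix.mulVec, dotProduct, Finset.mul_sum,
        Matrix.of_apply, chartMetric]
      rw [Finset.sum_comm]
      refine Finset.sum_congr rfl fun μ _ => Finset.sum_congr rfl fun ν _ => ?_
      rw [hA, ← mul_assoc, mul_comm (v ν), mul_assoc, mul_comm (v ν)]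
      rfl
    rw [this, hv0]
    simp
  have hAw : A w = 0 := by
    by_contra h
    exact (gs.pos _ _ h).ne' hq
  have hw0 : w = 0 := injective_mfderiv_chart_symm he hx (hAw.trans (map_zero A).symm)
  apply hv
  simpa [hw] using hw0

/-- The components are the smooth bundle metric evaluated on two coordinate vector fields, which are
smooth sections along `e.symm` since they come from its tangent map. -/
lemma differentiableAt_chartMetric [IsManifold (𝓡 m) ∞ M]
    (gs : Bundle.ContMDiffRiemannianMetric (𝓡 m) ∞ (EuclideanSpace ℝ (Fin m))
      (TangentSpace (𝓡 m) : M → Type _))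
    {e : OpenPartialHomeomorph M (EuclideanSpace ℝ (Fin m))}
    (he : e ∈ IsManifold.maximalAtlas (𝓡 m) ∞ M) {x : EuclideanSpace ℝ (Fin m)}
    (hx : x ∈ e.target) (μ ν : Fin m) :
    DifferentiableAt ℝ (fun y => chartMetric gs e y μ ν) x := by
  have hsymm := contMDiffOn_symm_of_mem_maximalAtlas he
  -- a coordinate vector field `∂_μ` along `e.symm` is `C¹`
  have hV : ∀ μ : Fin m, ContMDiffOn (𝓡 m) ((𝓡 m).prod (𝓡 m)) 1
      (fun y => (Bundle.TotalSpace.mk' (EuclideanSpace ℝ (Fin m)) (e.symm y)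
        (mfderiv (𝓡 m) (𝓡 m) e.symm y (EuclideanSpace.single μ (1 : ℝ))) : TangentBundle (𝓡 m) M))
      e.target := by
    intro μ
    have h1 := hsymm.contMDiffOn_tangentMapWithin (m := 1) (by norm_cast) e.open_target.uniqueMDiffOn
    have h2 : ContMDiff (𝓡 m) ((𝓡 m).prod (𝓡 m)) 1
        (fun y : EuclideanSpace ℝ (Fin m) => (⟨y, EuclideanSpace.single μ (1 : ℝ)⟩ :
          TangentBundle (𝓡 m) (EuclideanSpace ℝ (Fin m)))) := by
      intro y
      exact (contMDiffAt_vectorSpace_iff_contDiffAt (𝕜 := ℝ) (n := 1)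
        (V := fun _ => EuclideanSpace.single μ (1 : ℝ))).2 contDiffAt_const
    refine (h1.comp h2.contMDiffOn fun y hy => hy).congr fun y hy => ?_
    simp [tangentMapWithin, mfderivWithin_of_isOpen e.open_target hy]
  have hg : ContMDiffOn (𝓡 m) ((𝓡 m).prod 𝓘(ℝ)) 1
      (fun y => Bundle.TotalSpace.mk' ℝ (E := Bundle.Trivial M ℝ) (e.symm y)
        (chartMetric gs e y μ ν)) e.target := by
    apply ContMDiffOn.clm_bundle_apply₂ (F₁ := EuclideanSpace ℝ (Fin m))
      (F₂ := EuclideanSpace ℝ (Fin m))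
    · exact (gs.contMDiff.of_le (by simp)).comp_contMDiffOn (hsymm.of_le (by simp))
    · exact hV μ
    · exact hV ν
  have := (hg x hx).contMDiffAt (e.open_target.mem_nhds hx)
  rw [Bundle.contMDiffAt_totalSpace] at this
  exact (contMDiffAt_iff_contDiffAt.1 this.2).differentiableAt (by simp)

end Chart

/-- Read in a chart of the maximal atlas, the data of a doubly warped spacetime satisfy
`IsWarping`. -/
lemma isWarping_chart {m : ℕ} {M : Type*} [TopologicalSpace M]
    [ChartedSpace (EuclideanSpace ℝ (Fin m)) M] [IsManifold (𝓡 m) ∞ M]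
    (gs : Bundle.ContMDiffRiemannianMetric (𝓡 m) ∞ (EuclideanSpace ℝ (Fin m))
      (TangentSpace (𝓡 m) : M → Type _))
    {I : Set ℝ} (hI : IsOpen I)
    {a : ℝ → ℝ} (ha : ContDiffOn ℝ ∞ a I) (ha0 : ∀ t ∈ I, a t ≠ 0)
    {b : M → ℝ} (hb : ContMDiff (𝓡 m) 𝓘(ℝ, ℝ) ∞ b) (hb0 : ∀ p, b p ≠ 0)
    {e : OpenPartialHomeomorph M (EuclideanSpace ℝ (Fin m))}
    (he : e ∈ IsManifold.maximalAtlas (𝓡 m) ∞ M) :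
    IsWarping I ((WithLp.toLp 2 : (Fin m → ℝ) → EuclideanSpace ℝ (Fin m)) ⁻¹' e.target) a
      (fun x => b (e.symm (WithLp.toLp 2 x)))
      (fun x => Matrix.of (chartMetric gs e (WithLp.toLp 2 x))) := by
  have hL : ContDiff ℝ ∞ (WithLp.toLp 2 : (Fin m → ℝ) → EuclideanSpace ℝ (Fin m)) :=
    PiLp.contDiff_toLp
  exact
    { isOpen_time := hI
      isOpen_space := e.open_target.preimage hL.continuous
      contDiffOn_scale := ha.of_le (by norm_cast)
      scale_ne := ha0
      contDiffOn_lapse := ((contDiffOn_comp_chart_symm hb he).comp hL.contDiffOn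
        fun x hx => hx).of_le (by norm_cast)
      lapse_ne := fun x _ => hb0 _
      differentiableAt_space := fun x hx μ ν =>
        (differentiableAt_chartMetric gs he hx μ ν).comp x
          (hL.contDiffAt.differentiableAt (by simp))
      isSymm_space := fun x _ => Matrix.IsSymm.ext fun μ ν => chartMetric_symm gs e _ ν μ
      isUnit_det_space := fun x hx => isUnit_det_chartMetric gs he hx }

end DoublyWarped

end

open DoublyWarped in
theorem mainTheorem1 {m : ℕ} (hm : 2 ≤ m)
    {M : Type*} [TopologicalSpace M] [ChartedSpace (EuclideanSpace ℝ (Fin m)) M]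
    [IsManifold (𝓡 m) ∞ M]
    (gs : Bundle.ContMDiffRiemannianMetric (𝓡 m) ∞ (EuclideanSpace ℝ (Fin m))
      (TangentSpace (𝓡 m) : M → Type _))
    (I : Set ℝ) (hI : IsOpen I)
    (a : ℝ → ℝ) (ha : ContDiffOn ℝ ∞ a I) (ha0 : ∀ t ∈ I, a t ≠ 0)
    (b : M → ℝ) (hb : ContMDiff (𝓡 m) 𝓘(ℝ, ℝ) ∞ b) (hb0 : ∀ p, b p ≠ 0)
    (e : OpenPartialHomeomorph M (EuclideanSpace ℝ (Fin m)))
    (he : e ∈ IsManifold.maximalAtlas (𝓡 m) ∞ M)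
    (X : Fin (m + 1) → ℝ) (hXI : X 0 ∈ I) (hXe : spacePart X ∈ e.target) :
    let n : ℝ := (m : ℝ) + 1
    let g := metric a b gs e
    let u := velocity b e
    let u' := accel g u
    let R := scalarCurvature g X
    let φ := expansion g u X
    let ξ := xi g u X
    let η := eta g u X
    -- `D` is `∇^p u̇_p`, and `K` is `u̇^s ∇_s η`
    let D := divergence g u' X
    let K := scalarAlong g u' (eta g u) X
    let w := wVec g u X
    η ≠ 0 →
    ∀ j k : Fin (m + 1),
      ricci g X j k =
        u X j * u X k * ((R - n * ξ) / (n - 1) + D + η + K / (2 * η))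
        + g X j k * ((R - ξ) / (n - 1) + η + K / (2 * η))
        - (n - 2) * φ * (u X j * u' X k + u' X j * u X k)
        - u' X j * u' X k / η * ((n - 1) * (η + K / (2 * η)) - D)
        - (n - 2) * (u' X j * w k + w j * u' X k + piTensor g u X j k + electric g u X j k) := by
  intro n g u u' R φ ξ η D K w hη
  exact (isWarping_chart gs hI ha ha0 hb hb0 he).ricci_eq ⟨hXI, hXe⟩ hm hη
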